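/- Let $\mathbb{F}_q$ be a finite field with $q$ elements, $A=\mathbb{F}_q[\theta]$, $K_\infty=\mathbb{F}_q((\theta^{-1}))$ with $\|\theta\|=q$, and let $\mathbb{C}_\infty$ be the completion of an algebraic closure of $K_\infty$. Let $\Omega=A\,d\theta$ be the module of Kähler differentials of $A$ over $\mathbb{F}_q$. For an $\mathbb{F}_q$-vector space $M$ with the discrete topology, let $\hat M=\mathrm{Hom}_{\mathbb{F}_q}(M,\mathbb{F}_q)$ with the topology of pointwise convergence (the Pontryagin dual of $M$), and let $\mathbb{C}_\infty\hat\otimes M:=\mathrm{Hom}^{cont}_{\mathbb{F}_q}(\hat M,\mathbb{C}_\infty)$, where $c\otimes m$ is the map $g\mapsto g(m)c$. If $M$ is an $A$-module, then for $c\in\mathbb{C}_\infty$, $a\in A$ and $f\in\mathbb{C}_\infty\hat\otimes M$ the product $(c\otimes a)f$ is the map $g\mapsto c\,f(g\circ a)$, and the Frobenius twist $f^{(1)}$ is the map $g\mapsto f(g)^q$. Let $\phi$ be a Drinfeld $A$-module of rank $r\geq1$ over $\mathbb{C}_\infty$: a ring homomorphism $a\mapsto\phi_a$ from $A$ to $\mathbb{C}_\infty[\tau]\subseteq\mathrm{End}_{\mathbb{F}_q}(\mathbb{C}_\infty)$,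 where $\tau(x)=x^q$, such that for $a\neq0$ the operator $\phi_a$ has degree $r\deg a$ in $\tau$ and constant term $a$. Let $\Lambda\subseteq\mathbb{C}_\infty$ be its period lattice: the finitely generated $A$-submodule of rank $r$, with finitely many elements in each ball, such that $\phi_a(\exp_\Lambda(x))=\exp_\Lambda(ax)$ for all $a\in A$ and $x\in\mathbb{C}_\infty$, where $\exp_\Lambda(x)=x\prod_{\lambda\in\Lambda\setminus\{0\}}(1-x/\lambda)$. Let $\zeta_\phi=-\sum_{\lambda\in\Lambda\setminus\{0\}}\lambda^{-1}\otimes\lambda\in\mathbb{C}_\infty\hat\otimes\Lambda$ be the universal dual special function of $\phi$, that is, the map $g\mapsto-\sum_{\lambda\in\Lambda\setminus\{0\}}g(\lambda)\lambda^{-1}$. Let $\omega_\phi\in\mathbb{C}_\infty\hat\otimes\mathrm{Hom}_A(\Lambda,\Omega)$ be the universal special function of $\phi$: the unique element that, for all $b\in K_\infty$ and $\lambda\in\Lambda$, takes the value $\exp_\Lambda(b\lambda)$ at the functional $\mu\mapsto\mathrm{res}(b\,\mu(\lambda))$, where $\mathrm{res}(f\,d\theta)$ denotes the coefficient of $\theta^{-1}$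 in $f\in K_\infty$. Let $$ev:(\mathbb{C}_\infty\hat\otimes\Lambda)\otimes(\mathbb{C}_\infty\hat\otimes\mathrm{Hom}_A(\Lambda,\Omega))\to\mathbb{C}_\infty\hat\otimes\Omega,\qquad \sum_i c_i\otimes\lambda_i\;\otimes\;\sum_j d_j\otimes\mu_j\;\mapsto\;\sum_{i,j}c_id_j\otimes\mu_j(\lambda_i),$$ be the canonical pairing. Then the following holds in $\mathbb{C}_\infty\hat\otimes\Omega$: $$ev(\zeta_\phi\otimes\omega_\phi)=\frac{d\theta}{\theta\otimes1-1\otimes\theta},$$ that is, $ev(\zeta_\phi\otimes\omega_\phi)$ is the unique $g\in\mathbb{C}_\infty\hat\otimes\Omega$ with $(\theta\otimes1-1\otimes\theta)\,g=1\otimes d\theta$. Moreover, if $r\geq2$, then $$ev(\zeta_\phi\otimes\omega_\phi^{(1)})=0.$$ -/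

import Mathlib

open Polynomial Filter Topology
open scoped NNReal WithZero KaehlerDifferential

set_option linter.unusedSectionVars false
set_option linter.style.haveILetI false

noncomputable section

/-- `K∞ = F((1/θ))`, the completion of `F(θ)` at infinity: Laurent series in the variable `1/θ`. -/
def KInf (F : Type*) [Field F] : Type _ := LaurentSeries F

namespace KInf

variable (F : Type*) [Field F]

instance : Field (KInf F) := inferInstanceAs (Field (LaurentSeries F))
instance : Algebra F (KInf F) := (HahnSeries.C : F →+* LaurentSeries F).toAlgebra
instance : Valued (KInf F) ℤᵐ⁰ := inferInstanceAs (Valued (LaurentSeries F) ℤᵐ⁰)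
instance : CompleteSpace (KInf F) := inferInstanceAs (CompleteSpace (LaurentSeries F))

/-- The element `θ`, i.e. the inverse of the variable of the Laurent series. -/
def theta : KInf F := (HahnSeries.single (-1 : ℤ) (1 : F) : LaurentSeries F)

/-- `F[θ] → K∞`. -/
instance : Algebra F[X] (KInf F) := (aeval (theta F)).toRingHom.toAlgebra

instance : IsScalarTower F F[X] (KInf F) :=
  IsScalarTower.of_algebraMap_eq fun x => ((aeval (theta F)).commutes x).symm

variable [Finite F]

lemma one_lt_card : (1 : ℝ≥0) < (Nat.card F : ℝ≥0) := by
  exact_mod_cast Finite.one_lt_card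

lemma valuation_theta : Valued.v (theta F) = WithZero.exp (1 : ℤ) := by
  have := LaurentSeries.valuation_single_zpow F (-1)
  exact this.trans (by simp)

open MonoidWithZeroHom MonoidWithZeroHom.ValueGroup₀ in
/-- The normalisation of the absolute value: `‖θ‖ = q`. -/
instance : (Valued.v : Valuation (KInf F) ℤᵐ⁰).RankOne where
  hom' := (WithZeroMulInt.toNNReal (one_lt_card F).ne_zero).comp embedding
  strictMono' := (WithZeroMulInt.toNNReal_strictMono (one_lt_card F)).comp embedding_strictMono
  exists_val_nontrivial := ⟨theta F, by rw [valuation_theta]; simp, by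
    rw [valuation_theta, ← WithZero.exp_zero]; simp⟩

instance : NontriviallyNormedField (KInf F) :=
  Valued.toNontriviallyNormedField (KInf F) ℤᵐ⁰

instance : IsUltrametricDist (KInf F) :=
  IsUltrametricDist.isUltrametricDist_of_forall_norm_add_le_max_norm
    (Valued.isNonarchimedean_norm (KInf F) ℤᵐ⁰)

lemma norm_theta : ‖theta F‖ = Nat.card F := by
  have h : (‖theta F‖ : ℝ) =
      (WithZeroMulInt.toNNReal (one_lt_card F).ne_zero (Valued.v (theta F)) : ℝ≥0) := by
    rw [← Valuation.embedding_restrict]; rfl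
  rw [h, valuation_theta]
  rw [WithZeroMulInt.toNNReal_neg_apply _ (by simp)]
  simp [WithZero.exp]

end KInf

/-- The algebraic closure of `K∞`, with the unique extension of the absolute value. -/
abbrev KInfAlg (F : Type*) [Field F] : Type _ := AlgebraicClosure (KInf F)

namespace KInfAlg

variable (F : Type*) [Field F] [Finite F]

instance : NontriviallyNormedField (KInfAlg F) :=
  spectralNorm.nontriviallyNormedField (KInf F) (KInfAlg F)
instance : NormedAlgebra (KInf F) (KInfAlg F) := spectralNorm.normedAlgebra _ _
instance : IsUltrametricDist (KInfAlg F) :=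
  IsUltrametricDist.isUltrametricDist_of_forall_norm_add_le_max_norm
    (isNonarchimedean_spectralNorm (K := KInf F) (L := KInfAlg F))
instance : CompletableTopField (KInfAlg F) :=
  (NormedField.toValued (K := KInfAlg F)).completable
end KInfAlg

/-- `ℂ∞`, the completion of the algebraic closure of `K∞`. -/
def CInf (F : Type*) [Field F] [Finite F] : Type _ := UniformSpace.Completion (KInfAlg F)

namespace CInf
variable (F : Type*) [Field F] [Finite F]
instance : NormedField (CInf F) := inferInstanceAs (NormedField (UniformSpace.Completion (KInfAlg F)))
instance : CompleteSpace (CInf F) :=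
  inferInstanceAs (CompleteSpace (UniformSpace.Completion (KInfAlg F)))
instance : NormedAlgebra (KInf F) (CInf F) :=
  inferInstanceAs (NormedAlgebra (KInf F) (UniformSpace.Completion (KInfAlg F)))
instance : IsUltrametricDist (CInf F) := IsUltrametricDist.of_normedAlgebra (KInf F)
instance : Algebra F[X] (CInf F) := ((algebraMap (KInf F) (CInf F)).comp (algebraMap F[X] (KInf F))).toAlgebra
instance : Algebra F (CInf F) := ((algebraMap (KInf F) (CInf F)).comp (algebraMap F (KInf F))).toAlgebra
instance : IsScalarTower F[X] (KInf F) (CInf F) := IsScalarTower.of_algebraMap_eq fun _ => rfl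
instance : IsScalarTower F (KInf F) (CInf F) := IsScalarTower.of_algebraMap_eq fun _ => rfl
instance : IsScalarTower F F[X] (CInf F) := IsScalarTower.of_algebraMap_eq fun x => by
  rw [IsScalarTower.algebraMap_apply F (KInf F), IsScalarTower.algebraMap_apply F F[X] (KInf F)]; rfl
end CInf


/-! ### Completed tensor products -/

section CompletedTensor

variable {F : Type*} [Field F]

/-- For a discrete `F`-vector space `M` over a finite field `F`, the Pontryagin dual of `M` is
`Hom_F(M, F)` with the topology of pointwise convergence. -/
instance dualTopology (M : Type*) [AddCommGroup M] [Module F M] :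
    TopologicalSpace (Module.Dual F M) :=
  TopologicalSpace.induced (fun g m => g m) (@Pi.topologicalSpace M (fun _ => F) fun _ => ⊥)

section
variable {M : Type*} [AddCommGroup M] [Module F M]

lemma continuous_dual_eval {Y : Type*} [TopologicalSpace Y] (m : M) (f : F → Y) :
    Continuous fun g : Module.Dual F M => f (g m) := by
  let _ : TopologicalSpace F := ⊥
  have : DiscreteTopology F := ⟨rfl⟩
  have h : Continuous fun g : Module.Dual F M => (fun m => g m : M → F) := continuous_induced_dom
  exact (continuous_of_discreteTopology (f := f)).comp ((continuous_apply m).comp h)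

lemma continuous_dual_iff {Y : Type*} [TopologicalSpace Y] (f : Y → Module.Dual F M) :
    Continuous f ↔ ∀ m, @Continuous Y F _ ⊥ fun y => f y m := by
  let _ : TopologicalSpace F := ⊥
  rw [continuous_induced_rng, continuous_pi_iff]
  rfl

lemma continuous_dual_map {N : Type*} [AddCommGroup N] [Module F N]
    (T : Module.Dual F M → Module.Dual F N) (e : N → M) (h : ∀ g n, T g n = g (e n)) :
    Continuous T := by
  let _ : TopologicalSpace F := ⊥
  rw [continuous_dual_iff]
  intro n
  simp only [h]
  exact continuous_dual_eval (e n) id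

lemma tendsto_coord {ι : Type*} (b : Module.Basis ι F M) :
    Tendsto (fun i => b.coord i) cofinite (𝓝 0) := by
  let _ : TopologicalSpace F := ⊥
  rw [nhds_induced, tendsto_comap_iff, tendsto_pi_nhds]
  intro m
  refine tendsto_nhds_of_eventually_eq ?_
  have := (b.repr m).hasFiniteSupport
  filter_upwards [this.compl_mem_cofinite] with i hi
  simpa using hi

instance [Finite F] : CompactSpace (Module.Dual F M) := by
  let _ : TopologicalSpace F := ⊥
  have : DiscreteTopology F := ⟨rfl⟩
  have h : Topology.IsInducing fun g : Module.Dual F M => (fun m => g m : M → F) := ⟨rfl⟩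
  rw [← isCompact_univ_iff, h.isCompact_iff, Set.image_univ]
  exact (LinearMap.isClosed_range_coe M F (RingHom.id F)).isCompact
end

variable [Finite F]

lemma CInf.continuous_fsmul (a : F) : Continuous fun z : CInf F => a • z := by
  simp only [Algebra.smul_def]; fun_prop

lemma CInf.norm_fsmul_le (a : F) (z : CInf F) : ‖a • z‖ ≤ ‖z‖ := by
  by_cases ha : a = 0
  · simp [ha]
  have := Fintype.ofFinite F
  have h1 : ‖algebraMap F (CInf F) a‖ ^ (Fintype.card F - 1) = 1 := by
    rw [← norm_pow, ← map_pow, FiniteField.pow_card_sub_one_eq_one a ha]; simp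
  have h2 : ‖algebraMap F (CInf F) a‖ = 1 :=
    (pow_eq_one_iff_of_nonneg (norm_nonneg _)
      (Nat.sub_ne_zero_of_lt Fintype.one_lt_card)).1 h1
  rw [Algebra.smul_def, norm_mul, h2, one_mul]

variable (F) in
/-- `ℂ∞ ⊗̂ M`: the continuous `F`-linear maps from the Pontryagin dual of `M` to `ℂ∞`. -/
def CompletedTensor (M : Type*) [AddCommGroup M] [Module F M] :
    Submodule F (Module.Dual F M →ₗ[F] CInf F) where
  carrier := {f | Continuous f}
  add_mem' hf hg := Continuous.add hf hg
  zero_mem' := continuous_const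
  smul_mem' a _ hf := (CInf.continuous_fsmul a).comp hf

namespace CompletedTensor

variable {M : Type*} [AddCommGroup M] [Module F M]

instance : CoeFun (CompletedTensor F M) fun _ => Module.Dual F M → CInf F := ⟨fun f => f.1⟩

/-- The elementary tensor `c ⊗ m`, as the map `g ↦ g(m) c`. -/
def tmul (c : CInf F) (m : M) : CompletedTensor F M :=
  ⟨{ toFun := fun g => g m • c
     map_add' := fun g h => by simp [add_smul]
     map_smul' := fun a g => by simp [mul_smul] }, continuous_dual_eval m fun a => a • c⟩

/-- Multiplication by `c ⊗ 1`. -/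
def leftMul (c : CInf F) (f : CompletedTensor F M) : CompletedTensor F M :=
  ⟨{ toFun := fun g => c * f g
     map_add' := fun g h => by simp [mul_add]
     map_smul' := fun a g => by simp }, continuous_const.mul f.2⟩

/-- Multiplication by `1 ⊗ a`, for `a ∈ F[θ]`. -/
def rightMul [Module F[X] M] [IsScalarTower F F[X] M] (a : F[X]) (f : CompletedTensor F M) :
    CompletedTensor F M :=
  ⟨f.1 ∘ₗ LinearMap.lcomp F F (Algebra.lsmul F F M a), f.2.comp
    (continuous_dual_map _ (fun m => a • m) fun _ _ => rfl)⟩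

/-- The Frobenius twist `f ↦ f^(1)`, which raises the coefficients in `ℂ∞` to the power `q`. -/
def twist (f : CompletedTensor F M) : CompletedTensor F M :=
  ⟨{ toFun := fun g => f g ^ Nat.card F
     map_add' := fun g h => by
      have := Fintype.ofFinite F
      have := map_add (FiniteField.frobeniusAlgHom F (CInf F)) (f g) (f h)
      simpa [Nat.card_eq_fintype_card] using this
     map_smul' := fun a g => by
      have := Fintype.ofFinite F
      rw [map_smul, RingHom.id_apply, Algebra.smul_def, Algebra.smul_def, mul_pow, ← map_pow,
        Nat.card_eq_fintype_card, FiniteField.pow_card] }, f.2.pow _⟩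

end CompletedTensor

lemma CInf.summable_of_bound {ι : Type*} {f : ι → CInf F} {a : ι → ℝ}
    (ha : Tendsto a cofinite (𝓝 0)) (hb : ∀ i, ‖f i‖ ≤ a i) : Summable f :=
  NonarchimedeanAddGroup.summable_of_tendsto_cofinite_zero (squeeze_zero_norm hb ha)

/-- A nonarchimedean version of the Weierstrass test. -/
lemma CInf.continuous_tsum {ι Y : Type*} [TopologicalSpace Y] {f : ι → Y → CInf F} {a : ι → ℝ}
    (hc : ∀ i, Continuous (f i)) (ha : Tendsto a cofinite (𝓝 0)) (hb : ∀ i y, ‖f i y‖ ≤ a i) :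
    Continuous fun y => ∑' i, f i y := by
  classical
  have hs : ∀ y, Summable fun i => f i y := fun y => CInf.summable_of_bound ha fun i => hb i y
  have hu : TendstoUniformly (fun (s : Finset ι) y => ∑ i ∈ s, f i y) (fun y => ∑' i, f i y)
      atTop := by
    rw [Metric.tendstoUniformly_iff]
    intro ε hε
    have hfin : {i | ¬ a i < ε / 2}.Finite :=
      ha.eventually (gt_mem_nhds (half_pos hε))
    filter_upwards [eventually_ge_atTop hfin.toFinset] with s hs' y
    have h1 : Tendsto (fun t : Finset ι => dist (∑ i ∈ t, f i y) (∑ i ∈ s, f i y)) atTop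
        (𝓝 (dist (∑' i, f i y) (∑ i ∈ s, f i y))) := (hs y).hasSum.dist tendsto_const_nhds
    refine lt_of_le_of_lt (le_of_tendsto h1 ?_) (half_lt_self hε)
    filter_upwards [eventually_ge_atTop s] with t ht
    rw [dist_eq_norm, ← Finset.sum_sdiff ht, add_sub_cancel_right]
    refine IsUltrametricDist.norm_sum_le_of_forall_le_of_nonneg (half_pos hε).le fun i hi => ?_
    refine (hb i y).trans ?_
    by_contra hcon
    have : i ∈ hfin.toFinset := by
      simp only [Set.Finite.mem_toFinset, Set.mem_ofPred_eq]; intro h; exact hcon h.le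
    exact (Finset.mem_sdiff.1 hi).2 (hs' this)
  exact hu.continuous (Eventually.of_forall fun s => by fun_prop).frequently

end CompletedTensor

/-! ### The evaluation pairing -/

section Pairing

variable {F : Type*} [Field F] {L : Type*} [AddCommGroup L] [Module F[X] L] [Module F L]
  [IsScalarTower F F[X] L]

/-- For `l ∈ L` and `h` in the dual of `Ω`, the functional `μ ↦ h(μ(l))` on `Hom(L, Ω)`. -/
def evalDual (l : L) (h : Module.Dual F Ω[F[X]⁄F]) : Module.Dual F (L →ₗ[F[X]] Ω[F[X]⁄F]) where
  toFun μ := h (μ l)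
  map_add' μ ν := by simp
  map_smul' a μ := by simp

lemma continuous_evalDual (l : L) : Continuous (evalDual (F := F) l) :=
  continuous_dual_map _ (fun μ => μ l) fun _ _ => rfl

variable [Finite F]

lemma CompletedTensor.exists_bound {M : Type*} [AddCommGroup M] [Module F M]
    (y : CompletedTensor F M) : ∃ B : ℝ, ∀ u, ‖y u‖ ≤ B := by
  obtain ⟨B, hB⟩ := (isCompact_range y.2).isBounded.exists_norm_le
  exact ⟨B, fun u => hB _ ⟨u, rfl⟩⟩

lemma ev_tendsto (x : CompletedTensor F L) (B : ℝ) :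
    Tendsto (fun i => ‖x ((Module.Basis.ofVectorSpace F L).coord i)‖ * B) cofinite (𝓝 0) := by
  have := (x.2.tendsto 0).comp (tendsto_coord (Module.Basis.ofVectorSpace F L))
  simpa using (this.norm.mul_const B)

lemma ev_bound (x : CompletedTensor F L) (y : CompletedTensor F (L →ₗ[F[X]] Ω[F[X]⁄F])) {B : ℝ}
    (hB : ∀ u, ‖y u‖ ≤ B) (i) (h : Module.Dual F Ω[F[X]⁄F]) :
    ‖x ((Module.Basis.ofVectorSpace F L).coord i) *
        y (evalDual ((Module.Basis.ofVectorSpace F L) i) h)‖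
      ≤ ‖x ((Module.Basis.ofVectorSpace F L).coord i)‖ * B := by
  rw [norm_mul]; gcongr; exact hB _

/-- The pairing `(ℂ∞ ⊗̂ L) ⊗ (ℂ∞ ⊗̂ Hom(L, Ω)) → ℂ∞ ⊗̂ Ω` which maps
`(∑ᵢ cᵢ ⊗ lᵢ) ⊗ (∑ⱼ dⱼ ⊗ μⱼ)` to `∑ᵢⱼ cᵢ dⱼ ⊗ μⱼ(lᵢ)`. Here `x = ∑ᵢ x(lᵢ*) ⊗ lᵢ` for an
`F`-basis `(lᵢ)` of `L` with dual basis `(lᵢ*)`, and `h ∈ Ω^` takes the value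
`∑ⱼ dⱼ h(μⱼ(lᵢ)) = y(μ ↦ h(μ(lᵢ)))` on the second factor. -/
def ev (x : CompletedTensor F L) (y : CompletedTensor F (L →ₗ[F[X]] Ω[F[X]⁄F])) :
    CompletedTensor F Ω[F[X]⁄F] :=
  have hs : ∀ h, Summable fun i => x ((Module.Basis.ofVectorSpace F L).coord i) *
      y (evalDual ((Module.Basis.ofVectorSpace F L) i) h) := fun h => by
    obtain ⟨B, hB⟩ := CompletedTensor.exists_bound y
    exact CInf.summable_of_bound (ev_tendsto x B) fun i => ev_bound x y hB i h
  ⟨{ toFun := fun h => ∑' i, x ((Module.Basis.ofVectorSpace F L).coord i) *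
        y (evalDual ((Module.Basis.ofVectorSpace F L) i) h)
     map_add' := fun h k => by
      rw [← (hs h).tsum_add (hs k)]
      refine tsum_congr fun i => ?_
      rw [← mul_add, ← map_add]; rfl
     map_smul' := fun a h => by
      rw [RingHom.id_apply, Algebra.smul_def, ← tsum_mul_left]
      refine tsum_congr fun i => ?_
      rw [mul_left_comm, ← Algebra.smul_def, ← map_smul]; rfl }, by
    obtain ⟨B, hB⟩ := CompletedTensor.exists_bound y
    exact CInf.continuous_tsum
      (fun i => continuous_const.mul (y.2.comp (continuous_evalDual _)))
      (ev_tendsto x B) (ev_bound x y hB)⟩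

/-- On elementary tensors, `ev((c ⊗ l) ⊗ (d ⊗ μ)) = cd ⊗ μ(l)`. -/
lemma ev_tmul (c d : CInf F) (l : L) (μ : L →ₗ[F[X]] Ω[F[X]⁄F]) :
    ev (CompletedTensor.tmul c l) (CompletedTensor.tmul d μ) =
      CompletedTensor.tmul (c * d) (μ l) := by
  refine Subtype.ext (LinearMap.ext fun h => ?_)
  change ∑' i, (((Module.Basis.ofVectorSpace F L).coord i l) • c) * (h (μ _) • d) =
    h (μ l) • (c * d)
  set b := Module.Basis.ofVectorSpace F L
  rw [tsum_eq_sum (s := (b.repr l).support)]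
  · have : ∀ i, (b.coord i l • c) * (h (μ (b i)) • d) =
        (h (μ (b.coord i l • b i))) • (c * d) := by
      intro i
      rw [← algebraMap_smul F[X] (b.coord i l) (b i), map_smul, algebraMap_smul, map_smul,
        smul_mul_smul_comm]; rfl
    simp only [this]
    rw [← Finset.sum_smul, ← map_sum, ← map_sum]
    congr 3
    exact b.linearCombination_repr l
  · intro i hi
    have : b.coord i l = 0 := by simpa using hi
    rw [this]; simp

end Pairing
/-! ### Lattices, exponentials and Drinfeld modules -/

section Exponential

variable {F : Type*} [Field F] [Finite F]

lemma CInf.norm_prod_sub_one_le {ι : Type*} (s : Finset ι) (a : ι → CInf F) {ε : ℝ} (h0 : 0 ≤ ε)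
    (h1 : ε ≤ 1) (h : ∀ i ∈ s, ‖a i‖ ≤ ε) : ‖∏ i ∈ s, (1 - a i) - 1‖ ≤ ε := by
  classical
  induction s using Finset.induction_on with
  | empty => simpa using h0
  | insert j s hj ih =>
    have ih' := ih fun i hi => h i (Finset.mem_insert_of_mem hi)
    set P := ∏ i ∈ s, (1 - a i)
    have hP : ‖P‖ ≤ 1 := by
      have := IsUltrametricDist.norm_add_le_max (P - 1) 1
      rw [sub_add_cancel, norm_one] at this
      exact this.trans (max_le (ih'.trans h1) le_rfl)
    rw [Finset.prod_insert hj, show (1 - a j) * P - 1 = (P - 1) + (- (a j * P)) by ring]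
    refine (IsUltrametricDist.norm_add_le_max _ _).trans (max_le ih' ?_)
    rw [norm_neg, norm_mul]
    calc ‖a j‖ * ‖P‖ ≤ ε * 1 :=
          mul_le_mul (h j (Finset.mem_insert_self _ _)) hP (norm_nonneg _) h0
      _ = ε := mul_one _

lemma CInf.multipliable_one_sub {ι : Type*} {a : ι → CInf F} (ha : Tendsto a cofinite (𝓝 0)) :
    Multipliable fun i => 1 - a i := by
  classical
  have hfin : ∀ ε > 0, {i | ¬ ‖a i‖ < ε}.Finite := fun ε hε =>
    (by simpa using ha.norm : Tendsto (fun i => ‖a i‖) cofinite (𝓝 0)).eventually (gt_mem_nhds hε)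
  let s₀ := (hfin 1 one_pos).toFinset
  have hout : ∀ {ε : ℝ} (hε : 0 < ε) {s t : Finset ι}, (hfin ε hε).toFinset ⊆ s →
      ∀ i ∈ t \ s, ‖a i‖ ≤ ε := fun hε s t hs i hi => by
    by_contra hcon
    refine (Finset.mem_sdiff.1 hi).2 (hs ?_)
    simp only [Set.Finite.mem_toFinset, Set.mem_ofPred_eq]
    exact fun h => hcon h.le
  refine CompleteSpace.complete ?_
  change CauchySeq fun s : Finset ι => ∏ i ∈ s, (1 - a i)
  rw [Metric.cauchySeq_iff']
  intro ε hε
  let M : ℝ := ‖∏ i ∈ s₀, (1 - a i)‖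
  have hM : 0 < M + 1 := by positivity
  let δ := min 1 (ε / (M + 1) / 2)
  have hδ : 0 < δ := lt_min one_pos (by positivity)
  refine ⟨s₀ ∪ (hfin δ hδ).toFinset, fun t ht => ?_⟩
  set s := s₀ ∪ (hfin δ hδ).toFinset
  have hs : ‖∏ i ∈ s, (1 - a i)‖ ≤ M := by
    rw [← Finset.prod_sdiff (Finset.subset_union_left : s₀ ⊆ s), norm_mul]
    have h := CInf.norm_prod_sub_one_le (s \ s₀) a zero_le_one le_rfl
      (hout one_pos (subset_refl s₀))
    have h2 := IsUltrametricDist.norm_add_le_max (∏ i ∈ s \ s₀, (1 - a i) - 1) 1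
    rw [sub_add_cancel, norm_one] at h2
    exact mul_le_of_le_one_left (norm_nonneg _) (h2.trans (max_le h le_rfl))
  have hts := CInf.norm_prod_sub_one_le (t \ s) a hδ.le (min_le_left _ _)
    (hout hδ Finset.subset_union_right)
  rw [dist_eq_norm, ← Finset.prod_sdiff (show s ⊆ t from ht), ← sub_one_mul, norm_mul]
  calc _ ≤ δ * M := mul_le_mul hts hs (norm_nonneg _) hδ.le
    _ ≤ (ε / (M + 1) / 2) * (M + 1) :=
        mul_le_mul (min_le_right _ _) (by linarith) (norm_nonneg _) (by positivity)
    _ = ε / 2 := by field_simp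
    _ < ε := half_lt_self hε

lemma eval_prod_add {K : Type*} [Field K] (W : Finset K) (h0 : (0 : K) ∈ W)
    (hsub : ∀ x ∈ W, ∀ y ∈ W, x - y ∈ W) (x y : K) :
    ∏ w ∈ W, (x + y - w) = ∏ w ∈ W, (x - w) + ∏ w ∈ W, (y - w) := by
  have hadd : ∀ x ∈ W, ∀ y ∈ W, x + y ∈ W := fun x hx y hy => by
    simpa using hsub x hx _ (hsub 0 h0 y hy)
  let P : K[X] := ∏ w ∈ W, (X - C w)
  have hP : P.Monic := monic_prod_of_monic _ _ fun w _ => monic_X_sub_C w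
  have hdeg : P.degree = W.card := by
    simp [P, degree_prod]
  have hev : ∀ z, P.eval z = ∏ w ∈ W, (z - w) := fun z => by simp [P, eval_prod]
  have key : P.comp (X + C y) = P + C (P.eval y) := by
    refine eq_of_degree_sub_lt_of_eval_finset_eq W ?_ ?_
    · have hd : (P.comp (X + C y)).degree = P.degree := by
        rw [degree_eq_natDegree (hP.comp_X_add_C y).ne_zero, degree_eq_natDegree hP.ne_zero,
          natDegree_comp]
        simp
      have h1 : (P.comp (X + C y) - P).degree < W.card := by
        rw [← hdeg, ← hd]
        exact degree_sub_lt_left hd (hP.comp_X_add_C y).ne_zero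
          ((hP.comp_X_add_C y).leadingCoeff.trans hP.leadingCoeff.symm)
      rw [← sub_sub]
      refine (degree_sub_le _ _).trans_lt (max_lt h1 (degree_C_le.trans_lt ?_))
      exact_mod_cast Finset.card_pos.2 ⟨0, h0⟩
    · intro v hv
      have hv0 : P.eval v = 0 := by
        rw [hev]; exact Finset.prod_eq_zero hv (sub_self v)
      simp only [eval_comp, eval_add, eval_X, eval_C, hv0, zero_add]
      rw [hev, hev]
      refine Finset.prod_nbij' (· - v) (· + v) (fun w hw => hsub w hw v hv)
        (fun w hw => hadd w hw v hv) (fun w _ => by simp) (fun w _ => by simp) fun w _ => by ring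
  have := congrArg (eval x) key
  simpa only [eval_comp, eval_add, eval_X, eval_C, hev] using this

/-- An `F[θ]`-lattice in `ℂ∞`: a finitely generated submodule with finitely many elements in each
ball. -/
structure IsLattice (Λ : Submodule F[X] (CInf F)) : Prop where
  fg : Λ.FG
  finite_ball : ∀ R : ℝ, {x : CInf F | x ∈ Λ ∧ ‖x‖ ≤ R}.Finite

/-- `exp_Λ(x) = x ∏_{λ ∈ Λ ∖ {0}} (1 - x / λ)`. -/
def expLattice (Λ : Submodule F[X] (CInf F)) (x : CInf F) : CInf F :=
  x * ∏' l : {l : Λ // l ≠ 0}, (1 - x / ((l : Λ) : CInf F))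

namespace IsLattice

variable {Λ : Submodule F[X] (CInf F)}

lemma tendsto_div (hΛ : IsLattice Λ) (x : CInf F) :
    Tendsto (fun l : {l : Λ // l ≠ 0} => x / ((l : Λ) : CInf F)) cofinite (𝓝 0) := by
  rw [Metric.tendsto_nhds]
  intro ε hε
  have hinj : Function.Injective fun l : {l : Λ // l ≠ 0} => ((l : Λ) : CInf F) :=
    Subtype.val_injective.comp Subtype.val_injective
  refine ((hΛ.finite_ball (‖x‖ / ε)).preimage hinj.injOn).subset fun l hl => ?_
  refine ⟨l.1.2, ?_⟩
  have hl0 : 0 < ‖((l : Λ) : CInf F)‖ := norm_pos_iff.2 fun h => l.2 (Subtype.ext h)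
  replace hl : ¬ dist (x / ((l : Λ) : CInf F)) 0 < ε := hl
  rw [dist_zero_right, norm_div, not_lt, le_div_iff₀ hl0] at hl
  rw [le_div_iff₀ hε]
  linarith

open Classical in
/-- The nonzero elements of norm at most `n`. -/
def ballFinset (hΛ : IsLattice Λ) (n : ℕ) : Finset {l : Λ // l ≠ 0} :=
  ((hΛ.finite_ball n).preimage (f := fun l : {l : Λ // l ≠ 0} => ((l : Λ) : CInf F))
    (Subtype.val_injective.comp Subtype.val_injective).injOn).toFinset

lemma mem_ballFinset (hΛ : IsLattice Λ) (n : ℕ) (l : {l : Λ // l ≠ 0}) :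
    l ∈ hΛ.ballFinset n ↔ ‖((l : Λ) : CInf F)‖ ≤ n := by
  simp [ballFinset]

lemma tendsto_ballFinset (hΛ : IsLattice Λ) : Tendsto hΛ.ballFinset atTop atTop := by
  refine tendsto_atTop_finset_of_monotone (fun m n hmn l hl => ?_) fun l => ?_
  · rw [mem_ballFinset] at hl ⊢
    exact hl.trans (by exact_mod_cast hmn)
  · obtain ⟨n, hn⟩ := exists_nat_ge ‖((l : Λ) : CInf F)‖
    exact ⟨n, (hΛ.mem_ballFinset n l).2 hn⟩

lemma tendsto_exp (hΛ : IsLattice Λ) (x : CInf F) :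
    Tendsto (fun n => x * ∏ l ∈ hΛ.ballFinset n, (1 - x / ((l : Λ) : CInf F))) atTop
      (𝓝 (expLattice Λ x)) :=
  ((CInf.multipliable_one_sub (hΛ.tendsto_div x)).hasProd.comp hΛ.tendsto_ballFinset).const_mul x

lemma partial_eq (hΛ : IsLattice Λ) (n : ℕ) (x : CInf F) :
    x * ∏ l ∈ hΛ.ballFinset n, (1 - x / ((l : Λ) : CInf F)) =
      (∏ w ∈ (hΛ.finite_ball n).toFinset, (x - w)) *
        ∏ l ∈ hΛ.ballFinset n, (-((l : Λ) : CInf F))⁻¹ := by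
  classical
  have h0 : (0 : CInf F) ∈ (hΛ.finite_ball n).toFinset := by simp
  have hne : ∀ l : {l : Λ // l ≠ 0}, ((l : Λ) : CInf F) ≠ 0 := fun l h => l.2 (Subtype.ext h)
  rw [← Finset.mul_prod_erase _ _ h0, sub_zero, mul_assoc]
  congr 1
  have : ∏ w ∈ (hΛ.finite_ball n).toFinset.erase 0, (x - w) =
      ∏ l ∈ hΛ.ballFinset n, (x - ((l : Λ) : CInf F)) := by
    symm
    refine Finset.prod_bij (fun l _ => ((l : Λ) : CInf F)) ?_ ?_ ?_ ?_
    · intro l hl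
      simp only [Finset.mem_erase, Set.Finite.mem_toFinset, Set.mem_ofPred_eq]
      exact ⟨hne l, l.1.2, (hΛ.mem_ballFinset n l).1 hl⟩
    · intro l _ m _ h
      exact Subtype.ext (Subtype.ext h)
    · intro w hw
      simp only [Finset.mem_erase, Set.Finite.mem_toFinset, Set.mem_ofPred_eq] at hw
      exact ⟨⟨⟨w, hw.2.1⟩, fun h => hw.1 (congrArg Subtype.val h)⟩,
        (hΛ.mem_ballFinset n _).2 hw.2.2, rfl⟩
    · intros; rfl
  rw [this, ← Finset.prod_mul_distrib]
  refine Finset.prod_congr rfl fun l _ => ?_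
  have := hne l
  field_simp
  ring

lemma exp_add (hΛ : IsLattice Λ) (x y : CInf F) :
    expLattice Λ (x + y) = expLattice Λ x + expLattice Λ y := by
  refine tendsto_nhds_unique (hΛ.tendsto_exp (x + y)) ?_
  refine ((hΛ.tendsto_exp x).add (hΛ.tendsto_exp y)).congr fun n => ?_
  rw [partial_eq, partial_eq, partial_eq, ← add_mul, eval_prod_add]
  · simp
  · intro x hx y hy
    simp only [Set.Finite.mem_toFinset, Set.mem_ofPred_eq] at hx hy ⊢
    refine ⟨Λ.sub_mem hx.1 hy.1, ?_⟩
    have := IsUltrametricDist.norm_add_le_max x (-y)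
    rw [← sub_eq_add_neg, norm_neg] at this
    exact this.trans (max_le hx.2 hy.2)

lemma exp_smul (a : F) (x : CInf F) :
    expLattice Λ (a • x) = a • expLattice Λ x := by
  by_cases ha : a = 0
  · simp [ha, expLattice]
  have ha' : (C a : F[X]) ≠ 0 := by simpa using ha
  have hC : ∀ z : CInf F, (C a : F[X]) • z = a • z := fun z => by
    rw [← algebraMap_smul F[X] a z]; rfl
  have hmul : a⁻¹ * a = 1 := inv_mul_cancel₀ ha
  let e : {l : Λ // l ≠ 0} ≃ {l : Λ // l ≠ 0} :=
    { toFun := fun l => ⟨a • l.1, fun h => l.2 (by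
        have := congrArg (fun z => a⁻¹ • z) h
        simpa [smul_smul, hmul] using this)⟩
      invFun := fun l => ⟨a⁻¹ • l.1, fun h => l.2 (by
        have := congrArg (fun z => a • z) h
        simpa [smul_smul, mul_inv_cancel₀ ha] using this)⟩
      left_inv := fun l => by ext; simp [smul_smul, hmul]
      right_inv := fun l => by ext; simp [smul_smul, mul_inv_cancel₀ ha] }
  rw [expLattice, expLattice, ← e.tprod_eq, smul_mul_assoc]
  congr 2
  refine tprod_congr fun l => ?_
  have : algebraMap F (CInf F) a ≠ 0 := by simpa using ha
  have hl : (((e l : {l : Λ // l ≠ 0}) : Λ) : CInf F) = a • ((l : Λ) : CInf F) := rfl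
  rw [hl, Algebra.smul_def, Algebra.smul_def, mul_div_mul_left _ _ this]

lemma exp_eq_zero (hΛ : IsLattice Λ) (l : Λ) : expLattice Λ (l : CInf F) = 0 := by
  by_cases h : l = 0
  · simp [h, expLattice]
  have hne : (l : CInf F) ≠ 0 := fun h' => h (Subtype.ext h')
  refine tendsto_nhds_unique (hΛ.tendsto_exp _) (tendsto_nhds_of_eventually_eq ?_)
  obtain ⟨n, hn⟩ := exists_nat_ge ‖(l : CInf F)‖
  filter_upwards [eventually_ge_atTop n] with m hm
  have hmem : (⟨l, h⟩ : {l : Λ // l ≠ 0}) ∈ hΛ.ballFinset m :=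
    (hΛ.mem_ballFinset _ _).2 (hn.trans (by exact_mod_cast hm))
  rw [Finset.prod_eq_zero hmem (by simp [hne]), mul_zero]

/-- `exp_Λ` as an `F`-linear map. -/
def expLinear (hΛ : IsLattice Λ) : CInf F →ₗ[F] CInf F where
  toFun := expLattice Λ
  map_add' := hΛ.exp_add
  map_smul' := exp_smul

lemma continuous_exp (hΛ : IsLattice Λ) : Continuous (expLattice Λ) := by
  refine continuous_of_continuousAt_zero hΛ.expLinear.toAddMonoidHom ?_
  change ContinuousAt (expLattice Λ) 0
  have h0 : expLattice Λ 0 = 0 := by simp [expLattice]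
  have hinj : Function.Injective fun l : {l : Λ // l ≠ 0} => ((l : Λ) : CInf F) :=
    Subtype.val_injective.comp Subtype.val_injective
  rw [ContinuousAt, h0]
  have hδ : ∃ δ > 0, ∀ l : {l : Λ // l ≠ 0}, δ ≤ ‖((l : Λ) : CInf F)‖ := by
    have hne : ∀ l : {l : Λ // l ≠ 0}, 0 < ‖((l : Λ) : CInf F)‖ :=
      fun l => norm_pos_iff.2 fun h => l.2 (Subtype.ext h)
    rcases (hΛ.ballFinset 1).eq_empty_or_nonempty with he | he
    · refine ⟨1, one_pos, fun l => ?_⟩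
      by_contra hl
      have : l ∈ hΛ.ballFinset 1 := (hΛ.mem_ballFinset _ _).2 (by simpa using (not_le.1 hl).le)
      simp [he] at this
    · obtain ⟨m, hm, hmin⟩ := (hΛ.ballFinset 1).exists_min_image
        (fun l => ‖((l : Λ) : CInf F)‖) he
      refine ⟨_, hne m, fun l => ?_⟩
      by_cases hl : l ∈ hΛ.ballFinset 1
      · exact hmin l hl
      · rw [mem_ballFinset] at hl hm
        exact hm.trans (not_le.1 hl).le
  obtain ⟨δ, hδ, hle⟩ := hδ
  refine squeeze_zero_norm' (a := fun x => ‖x‖) ?_ (by simpa using tendsto_norm_zero)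
  filter_upwards [Metric.ball_mem_nhds (0 : CInf F) hδ] with x hx
  rw [mem_ball_zero_iff] at hx
  refine le_of_tendsto (hΛ.tendsto_exp x).norm (Eventually.of_forall fun n => ?_)
  rw [norm_mul]
  refine mul_le_of_le_one_right (norm_nonneg _) ?_
  have h := CInf.norm_prod_sub_one_le (hΛ.ballFinset n)
    (fun l => x / ((l : Λ) : CInf F)) zero_le_one le_rfl fun l _ => by
      rw [norm_div]
      exact div_le_one_of_le₀ (hx.le.trans (hle l)) (norm_nonneg _)
  have h2 := IsUltrametricDist.norm_add_le_max
    (∏ l ∈ hΛ.ballFinset n, (1 - x / ((l : Λ) : CInf F)) - 1) 1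
  rw [sub_add_cancel, norm_one] at h2
  exact h2.trans (max_le h le_rfl)

end IsLattice

end Exponential

section Universal

variable {F : Type*} [Field F]

namespace KInf

/-- The coefficient of `θ^(-n)`. -/
def coeff (n : ℤ) : KInf F →ₗ[F] F where
  toFun b := HahnSeries.coeff (b : LaurentSeries F) n
  map_add' _ _ := HahnSeries.coeff_add
  map_smul' a b := congrArg (fun c : LaurentSeries F => HahnSeries.coeff c n)
    (HahnSeries.C_mul_eq_smul (Γ := ℤ) (r := a) (x := (b : LaurentSeries F)))

lemma ext_coeff {b c : KInf F} (h : ∀ n, coeff n b = coeff n c) : b = c :=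
  HahnSeries.ext (_root_.funext h)

/-- The monomial `θ^(-n)`. -/
def mono (n : ℤ) : KInf F := (HahnSeries.single n (1 : F) : LaurentSeries F)

lemma coeff_mono (m n : ℤ) : coeff m (mono (F := F) n) = if m = n then 1 else 0 := by
  classical
  exact HahnSeries.coeff_single.trans (by congr)

lemma mono_mul (m n : ℤ) : mono (F := F) m * mono n = mono (m + n) := by
  have := HahnSeries.single_mul_single (a := m) (b := n) (r := (1 : F)) (s := (1 : F))
  rw [mul_one] at this
  exact this

lemma mono_zero : mono (F := F) 0 = 1 := rfl

lemma theta_pow (k : ℕ) : theta F ^ k = mono (-(k : ℤ)) := by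
  induction k with
  | zero => simp [mono_zero]
  | succ k ih =>
    rw [pow_succ, ih, show theta F = mono (-1) from rfl, mono_mul]
    congr 1; push_cast; ring

lemma coeff_mul_theta_pow (b : KInf F) (n : ℤ) (k : ℕ) :
    coeff n (b * theta F ^ k) = coeff (n + k) b := by
  rw [theta_pow]
  have := HahnSeries.coeff_mul_single_add (x := (b : LaurentSeries F)) (r := (1 : F))
    (a := n + k) (b := -(k : ℤ))
  rw [add_neg_cancel_right, mul_one] at this
  exact this

lemma theta_inv_pow (k : ℕ) : (theta F)⁻¹ ^ k = mono (k : ℤ) := by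
  rw [inv_pow]
  refine inv_eq_of_mul_eq_one_right ?_
  rw [theta_pow, mono_mul, neg_add_cancel, mono_zero]

lemma coeff_theta_inv_pow (n : ℤ) (k : ℕ) :
    coeff n ((theta F)⁻¹ ^ k) = if n = k then 1 else 0 := by
  rw [theta_inv_pow, coeff_mono]

lemma coeff_theta_pow (n : ℤ) (k : ℕ) :
    coeff n (theta F ^ k) = if n = -(k : ℤ) then 1 else 0 := by
  rw [theta_pow, coeff_mono]

lemma coeff_algebraMap (a : F[X]) (k : ℕ) :
    coeff (-(k : ℤ)) (algebraMap F[X] (KInf F) a) = a.coeff k := by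
  change coeff (-(k : ℤ)) (aeval (theta F) a) = _
  rw [aeval_eq_sum_range, map_sum]
  simp only [map_smul, coeff_theta_pow, smul_eq_mul, mul_ite, mul_one, mul_zero, neg_inj,
    Nat.cast_inj]
  rw [Finset.sum_ite_eq]
  split_ifs with h
  · rfl
  · exact (coeff_eq_zero_of_natDegree_lt (by simpa using h)).symm

lemma algebraMap_injective : Function.Injective (algebraMap F[X] (KInf F)) := fun a b h => by
  ext k
  rw [← coeff_algebraMap, h, coeff_algebraMap]

lemma algebraMap_X : algebraMap F[X] (KInf F) X = theta F := aeval_X (theta F)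

variable [Finite F]

lemma norm_le_theta_inv_pow {f : KInf F} {k : ℕ} (h : ∀ n : ℤ, n < k → coeff n f = 0) :
    ‖f‖ ≤ ‖(theta F)⁻¹ ^ k‖ := by
  refine Valued.toNormedField.norm_le_iff.2 ?_
  have h1 : Valued.v ((theta F)⁻¹ ^ k) = WithZero.exp (-(k : ℤ)) := by
    rw [theta_inv_pow]; exact LaurentSeries.valuation_single_zpow F k
  rw [h1]
  exact (LaurentSeries.valuation_le_iff_coeff_lt_eq_zero F).2 h

lemma norm_theta_inv_lt_one : ‖(theta F)⁻¹‖ < 1 := by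
  rw [norm_inv, norm_theta]
  exact inv_lt_one_of_one_lt₀ (by exact_mod_cast Finite.one_lt_card)

lemma norm_fsmul_le (a : F) (b : KInf F) : ‖a • b‖ ≤ ‖b‖ := by
  refine Valued.toNormedField.norm_le_iff.2 ?_
  by_cases hb : b = 0
  · simp [hb]
  have hb' : Valued.v b ≠ 0 := (Valuation.ne_zero_iff _).2 hb
  refine (LaurentSeries.valuation_le_iff_coeff_lt_log_eq_zero F hb').2 fun n hn => ?_
  have := (LaurentSeries.valuation_le_iff_coeff_lt_log_eq_zero F hb').1 le_rfl n hn
  change coeff n (a • b) = 0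
  rw [map_smul]
  change a • HahnSeries.coeff (b : LaurentSeries F) n = 0
  erw [this, smul_zero]

/-- Every element of `K∞` is the sum of a polynomial and of a series in `θ⁻¹`
without constant term. -/
lemma exists_hasSum (f : KInf F) : ∃ a : F[X],
    HasSum (fun j : ℕ => coeff (j + 1) f • (theta F)⁻¹ ^ (j + 1)) (f - algebraMap F[X] _ a) := by
  obtain ⟨N, hN⟩ : ∃ N : ℕ, ∀ n : ℤ, n < -(N : ℤ) → coeff n f = 0 := by
    refine ⟨(-HahnSeries.order (f : LaurentSeries F)).toNat, fun n hn => ?_⟩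
    exact HahnSeries.coeff_eq_zero_of_lt_order (by omega)
  let a : F[X] := ∑ k ∈ Finset.range (N + 1), coeff (-(k : ℤ)) f • X ^ k
  have ha : algebraMap F[X] (KInf F) a =
      ∑ k ∈ Finset.range (N + 1), coeff (-(k : ℤ)) f • theta F ^ k := by
    change aeval (theta F) a = _
    simp [a]
  have hca : ∀ n : ℤ, coeff n (algebraMap F[X] (KInf F) a) = if n ≤ 0 then coeff n f else 0 := by
    intro n
    rw [ha, map_sum]
    simp only [map_smul, coeff_theta_pow, smul_eq_mul, mul_ite, mul_one, mul_zero]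
    split_ifs with hn
    · by_cases hn' : n < -(N : ℤ)
      · rw [hN n hn']
        refine Finset.sum_eq_zero fun k hk => ?_
        rw [Finset.mem_range] at hk
        rw [if_neg (by omega)]
      · rw [Finset.sum_eq_single (-n).toNat]
        · have : -(((-n).toNat : ℕ) : ℤ) = n := by omega
          rw [this, if_pos rfl]
        · intro k _ hk
          rw [if_neg (by omega)]
        · intro hk
          rw [Finset.mem_range] at hk
          omega
    · exact Finset.sum_eq_zero fun k _ => if_neg (by omega)
  refine ⟨a, ?_⟩
  have hpow : Tendsto (fun j : ℕ => ‖(theta F)⁻¹ ^ (j + 1)‖) atTop (𝓝 0) := by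
    simp only [norm_pow]
    exact (tendsto_pow_atTop_nhds_zero_of_lt_one (norm_nonneg _) norm_theta_inv_lt_one).comp
      (tendsto_add_atTop_nat 1)
  have hs : Summable fun j : ℕ => coeff (j + 1) f • (theta F)⁻¹ ^ (j + 1) := by
    refine NonarchimedeanAddGroup.summable_of_tendsto_cofinite_zero ?_
    rw [Nat.cofinite_eq_atTop]
    exact squeeze_zero_norm (fun j => norm_fsmul_le _ _) hpow
  have hlim : Tendsto (fun n => ∑ j ∈ Finset.range n, coeff (j + 1) f • (theta F)⁻¹ ^ (j + 1))
      atTop (𝓝 (f - algebraMap F[X] _ a)) := by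
    rw [tendsto_iff_norm_sub_tendsto_zero]
    refine squeeze_zero (fun _ => norm_nonneg _) (fun n => ?_) hpow
    rw [norm_sub_rev]
    refine norm_le_theta_inv_pow fun m hm => ?_
    rw [map_sub, map_sub, hca, map_sum]
    simp only [map_smul, coeff_theta_inv_pow, smul_eq_mul, mul_ite, mul_one, mul_zero]
    push_cast at hm ⊢
    split_ifs with hm0
    · rw [Finset.sum_eq_zero fun k _ => if_neg (by omega)]; simp
    · rw [Finset.sum_eq_single (m - 1).toNat]
      · have : (((m - 1).toNat : ℕ) : ℤ) + 1 = m := by omega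
        rw [this, if_pos rfl]; simp
      · intro k _ hk
        rw [if_neg (by omega)]
      · intro hk
        rw [Finset.mem_range] at hk
        omega
  rw [← tendsto_nhds_unique hs.hasSum.tendsto_sum_nat hlim]
  exact hs.hasSum

end KInf

variable [Finite F] {Λ : Submodule F[X] (CInf F)}

/-- The functional on `Hom(Λ, Ω)` attached to `b ⊗ l ∈ K∞ ⊗ Λ` by the residue pairing: it maps `μ`
to the residue of `b μ(l)`. The residue of `f dθ` is the coefficient of `θ⁻¹` in `f`. -/
def resDual (b : KInf F) (l : Λ) : Module.Dual F (Λ →ₗ[F[X]] Ω[F[X]⁄F]) where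
  toFun μ := KInf.coeff 1 (b * algebraMap F[X] (KInf F) (KaehlerDifferential.polynomialEquiv F (μ l)))
  map_add' μ ν := by simp [mul_add]
  map_smul' a μ := by
    have : KaehlerDifferential.polynomialEquiv F ((a • μ) l) =
        a • KaehlerDifferential.polynomialEquiv F (μ l) := by
      rw [LinearMap.smul_apply, ← algebraMap_smul F[X] a (μ l), map_smul, algebraMap_smul]
    rw [this, Algebra.smul_def a, map_mul (algebraMap F[X] (KInf F)), ← IsScalarTower.algebraMap_apply F F[X] (KInf F),
      mul_left_comm, ← Algebra.smul_def, map_smul, RingHom.id_apply]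

lemma resDual_apply (b : KInf F) (l : Λ) (μ : Λ →ₗ[F[X]] Ω[F[X]⁄F]) :
    resDual b l μ = KInf.coeff 1
      (b * algebraMap F[X] (KInf F) (KaehlerDifferential.polynomialEquiv F (μ l))) := rfl

/-- `ω ∈ ℂ∞ ⊗̂ Hom(Λ, Ω)` is the universal special function: as a function on the Pontryagin dual
`K∞ ⊗ Λ / Λ` of `Hom(Λ, Ω)`, it is induced by `exp_Λ : K∞Λ → ℂ∞`. -/
def IsUniversalSpecialFunction (Λ : Submodule F[X] (CInf F))
    (ω : CompletedTensor F (Λ →ₗ[F[X]] Ω[F[X]⁄F])) : Prop :=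
  ∀ (b : KInf F) (l : Λ), ω (resDual b l) = expLattice Λ (b • (l : CInf F))

namespace IsLattice

lemma free (hΛ : IsLattice Λ) : Module.Finite F[X] Λ ∧ Module.Free F[X] Λ := by
  have : Module.Finite F[X] Λ := Module.Finite.iff_fg.2 hΛ.fg
  have hinj : Function.Injective (algebraMap F[X] (CInf F)) :=
    (algebraMap (KInf F) (CInf F)).injective.comp KInf.algebraMap_injective
  have : IsDomain F[X] := inferInstance
  have : FaithfulSMul F[X] (CInf F) := (faithfulSMul_iff_algebraMap_injective _ _).2 hinj
  have : Module.IsTorsionFree F[X] (CInf F) := inferInstance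
  have : Module.IsTorsionFree F[X] Λ := inferInstance
  exact ⟨‹_›, inferInstance⟩

/-- The homomorphism `l ↦ p πᵢ*(l) dθ`, for an `F[θ]`-basis `(πᵢ)` of `Λ`. -/
def basisHom {ι : Type*} (π : Module.Basis ι F[X] Λ) (i : ι) (p : F[X]) :
    Λ →ₗ[F[X]] Ω[F[X]⁄F] :=
  (p • π.coord i).smulRight (KaehlerDifferential.D F F[X] X)

lemma polynomialEquiv_smul_D (p : F[X]) :
    KaehlerDifferential.polynomialEquiv F (p • KaehlerDifferential.D F F[X] X) = p := by
  simp

lemma resDual_basisHom {ι : Type*} (π : Module.Basis ι F[X] Λ) (i : ι) (b : KInf F) (l : Λ)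
    (j : ℕ) : resDual b l (basisHom π i (X ^ j)) =
      KInf.coeff (j + 1) (b * algebraMap F[X] (KInf F) (π.coord i l)) := by
  have h : basisHom π i (X ^ j) l =
      (X ^ j * π.coord i l) • KaehlerDifferential.D F F[X] X := rfl
  rw [resDual_apply, h, polynomialEquiv_smul_D, map_mul (algebraMap F[X] (KInf F)),
    map_pow (algebraMap F[X] (KInf F)), KInf.algebraMap_X, mul_left_comm, mul_comm,
    KInf.coeff_mul_theta_pow, add_comm]

lemma theta_pow_tendsto :
    Tendsto (fun j : ℕ => ‖algebraMap (KInf F) (CInf F) ((KInf.theta F)⁻¹ ^ (j + 1))‖)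
      cofinite (𝓝 0) := by
  rw [Nat.cofinite_eq_atTop]
  simp only [norm_algebraMap', norm_pow]
  exact (tendsto_pow_atTop_nhds_zero_of_lt_one (norm_nonneg _) KInf.norm_theta_inv_lt_one).comp
      (tendsto_add_atTop_nat 1)

/-- The `K∞`-coordinate at `πᵢ` of a representative in `K∞Λ` of a functional on `Hom(Λ, Ω)`. -/
def coordMap {ι : Type*} (π : Module.Basis ι F[X] Λ) (i : ι) :
    Module.Dual F (Λ →ₗ[F[X]] Ω[F[X]⁄F]) →ₗ[F] CInf F :=
  have hs : ∀ u : Module.Dual F (Λ →ₗ[F[X]] Ω[F[X]⁄F]), Summable fun j : ℕ =>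
      u (basisHom π i (X ^ j)) • algebraMap (KInf F) (CInf F) ((KInf.theta F)⁻¹ ^ (j + 1)) :=
    fun u => CInf.summable_of_bound theta_pow_tendsto fun j => CInf.norm_fsmul_le _ _
  { toFun := fun u => ∑' j : ℕ,
      u (basisHom π i (X ^ j)) • algebraMap (KInf F) (CInf F) ((KInf.theta F)⁻¹ ^ (j + 1))
    map_add' := fun u v => by
      rw [← (hs u).tsum_add (hs v)]
      exact tsum_congr fun j => by rw [LinearMap.add_apply, add_smul]
    map_smul' := fun a u => by
      rw [RingHom.id_apply, Algebra.smul_def, ← tsum_mul_left]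
      exact tsum_congr fun j => by
        rw [← Algebra.smul_def, smul_smul, LinearMap.smul_apply, smul_eq_mul] }

lemma continuous_coordMap {ι : Type*} (π : Module.Basis ι F[X] Λ) (i : ι) :
    Continuous (coordMap π i) :=
  CInf.continuous_tsum (fun j => continuous_dual_eval (basisHom π i (X ^ j))
    fun a => a • algebraMap (KInf F) (CInf F) ((KInf.theta F)⁻¹ ^ (j + 1)))
    theta_pow_tendsto fun _ _ => CInf.norm_fsmul_le _ _

lemma coordMap_resDual {ι : Type*} (π : Module.Basis ι F[X] Λ) (i : ι) (b : KInf F) (l : Λ) :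
    ∃ a : F[X], coordMap π i (resDual b l) =
      algebraMap (KInf F) (CInf F) (b * algebraMap F[X] (KInf F) (π.coord i l)) -
        algebraMap F[X] (CInf F) a := by
  obtain ⟨a, ha⟩ := KInf.exists_hasSum (b * algebraMap F[X] (KInf F) (π.coord i l))
  refine ⟨a, ?_⟩
  have h := ha.map (algebraMap (KInf F) (CInf F)) (algebraMapCLM (KInf F) (CInf F)).continuous
  rw [map_sub] at h
  refine Eq.trans ?_ h.tsum_eq
  refine tsum_congr fun j => ?_
  rw [resDual_basisHom, Function.comp_apply, Algebra.smul_def, Algebra.smul_def,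
    map_mul (algebraMap (KInf F) (CInf F)), ← IsScalarTower.algebraMap_apply]

lemma exists_universal (hΛ : IsLattice Λ) : ∃ ω, IsUniversalSpecialFunction Λ ω := by
  obtain ⟨_, _⟩ := hΛ.free
  let π := Module.Free.chooseBasis F[X] Λ
  let T : Module.Dual F (Λ →ₗ[F[X]] Ω[F[X]⁄F]) →ₗ[F] CInf F :=
    ∑ i, LinearMap.mulRight F ((π i : Λ) : CInf F) ∘ₗ coordMap π i
  have hT : ∀ u, T u = ∑ i, coordMap π i u * ((π i : Λ) : CInf F) := fun u => by simp [T]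
  refine ⟨⟨hΛ.expLinear ∘ₗ T, hΛ.continuous_exp.comp ?_⟩, fun b l => ?_⟩
  · rw [show (T : _ → CInf F) = _ from _root_.funext hT]
    exact continuous_finsetSum _ fun i _ => (continuous_coordMap π i).mul continuous_const
  · choose a ha using fun i => coordMap_resDual π i b l
    have hl : (l : CInf F) = ∑ i, algebraMap F[X] (CInf F) (π.coord i l) * ((π i : Λ) : CInf F) := by
      have h := congrArg (Subtype.val : Λ → CInf F) (π.sum_repr l)
      rw [AddSubmonoidClass.coe_finsetSum] at h
      rw [← h]
      refine Finset.sum_congr rfl fun i _ => ?_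
      rw [Submodule.coe_smul, Algebra.smul_def, Module.Basis.coord_apply]
    have hTl : T (resDual b l) = b • (l : CInf F) + -((∑ i, a i • π i : Λ) : CInf F) := by
      rw [hT, hl, Finset.smul_sum, ← sub_eq_add_neg, AddSubmonoidClass.coe_finsetSum,
        ← Finset.sum_sub_distrib]
      refine Finset.sum_congr rfl fun i _ => ?_
      rw [ha, map_mul, Submodule.coe_smul, Algebra.smul_def (a i), Algebra.smul_def b, sub_mul,
        mul_assoc, ← IsScalarTower.algebraMap_apply F[X] (KInf F) (CInf F)]
    change expLattice Λ (T (resDual b l)) = _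
    rw [hTl, hΛ.exp_add, ← Submodule.coe_neg, hΛ.exp_eq_zero, add_zero]

lemma exists_eq_sum_resDual {ι : Type*} [Fintype ι] (π : Module.Basis ι F[X] Λ)
    (u : Module.Dual F (Λ →ₗ[F[X]] Ω[F[X]⁄F])) : ∃ b : ι → KInf F, u = ∑ i, resDual (b i) (π i) := by
  classical
  let b : ι → KInf F := fun i => (HahnSeries.ofPowerSeries ℤ F (PowerSeries.mk fun n =>
    u (basisHom π i (X ^ (n - 1)))) : LaurentSeries F)
  have hb : ∀ i (j : ℕ), KInf.coeff (1 + j) (b i) = u (basisHom π i (X ^ j)) := by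
    intro i j
    have : ((1 : ℤ) + j) = ((j + 1 : ℕ) : ℤ) := by push_cast; ring
    rw [this]
    refine (HahnSeries.ofPowerSeries_apply_coeff (Γ := ℤ) _ (j + 1)).trans ?_
    simp
  refine ⟨b, LinearMap.ext fun μ => ?_⟩
  have key : ∀ i (p : F[X]), u (basisHom π i p) =
      KInf.coeff 1 (b i * algebraMap F[X] (KInf F) p) := by
    intro i p
    induction p using Polynomial.induction_on' with
    | add p q hp hq =>
      have : basisHom π i (p + q) = basisHom π i p + basisHom π i q := by
        ext; simp [basisHom, add_smul]
      rw [this, map_add, hp, hq, map_add (algebraMap F[X] (KInf F)), mul_add, map_add]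
    | monomial n a =>
      have h1 : basisHom π i (monomial n a) = a • basisHom π i (X ^ n) := by
        refine LinearMap.ext fun l => ?_
        simp only [basisHom, LinearMap.smul_apply, LinearMap.smulRight_apply, smul_eq_mul]
        rw [← C_mul_X_pow_eq_monomial, mul_assoc, mul_smul, ← algebraMap_smul F[X] a]; rfl
      rw [h1, map_smul, ← hb, ← C_mul_X_pow_eq_monomial, map_mul (algebraMap F[X] (KInf F)),
        map_pow (algebraMap F[X] (KInf F)), KInf.algebraMap_X, mul_left_comm,
        show algebraMap F[X] (KInf F) (C a) = algebraMap F (KInf F) a from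
          (IsScalarTower.algebraMap_apply F F[X] (KInf F) a).symm,
        ← Algebra.smul_def, map_smul, KInf.coeff_mul_theta_pow]
  have hμ : μ = ∑ i, basisHom π i (KaehlerDifferential.polynomialEquiv F (μ (π i))) := by
    refine π.ext fun k => ?_
    rw [LinearMap.sum_apply, Finset.sum_eq_single k]
    · apply (KaehlerDifferential.polynomialEquiv F).injective
      simp [basisHom]
    · intro i _ hi
      simp [basisHom, hi.symm]
    · simp
  conv_lhs => rw [hμ]
  rw [map_sum, LinearMap.sum_apply]
  exact Finset.sum_congr rfl fun i _ => key i _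

theorem existsUnique_universal (hΛ : IsLattice Λ) :
    ∃! ω, IsUniversalSpecialFunction Λ ω := by
  obtain ⟨_, _⟩ := hΛ.free
  obtain ⟨ω, hω⟩ := hΛ.exists_universal
  refine ⟨ω, hω, fun ω' hω' => Subtype.ext (LinearMap.ext fun u => ?_)⟩
  obtain ⟨b, rfl⟩ := exists_eq_sum_resDual (Module.Free.chooseBasis F[X] Λ) u
  rw [map_sum, map_sum]
  exact Finset.sum_congr rfl fun i _ => (hω' _ _).trans (hω _ _).symm

/-- The universal special function `ω ∈ ℂ∞ ⊗̂ Hom(Λ, Ω)`. -/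
def omega (hΛ : IsLattice Λ) : CompletedTensor F (Λ →ₗ[F[X]] Ω[F[X]⁄F]) :=
  hΛ.existsUnique_universal.choose

lemma tendsto_norm_inv (hΛ : IsLattice Λ) :
    Tendsto (fun l : {l : Λ // l ≠ 0} => ‖((l : Λ) : CInf F)⁻¹‖) cofinite (𝓝 0) := by
  simpa using (hΛ.tendsto_div 1).norm

/-- The universal dual special function `ζ = -∑_{λ ∈ Λ ∖ {0}} λ⁻¹ ⊗ λ ∈ ℂ∞ ⊗̂ Λ`, as the map
`g ↦ -∑ g(λ) λ⁻¹` on the Pontryagin dual of `Λ`. -/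
def zeta (hΛ : IsLattice Λ) : CompletedTensor F Λ :=
  have hs : ∀ g : Module.Dual F Λ, Summable fun l : {l : Λ // l ≠ 0} =>
      g l • ((l : Λ) : CInf F)⁻¹ :=
    fun g => CInf.summable_of_bound hΛ.tendsto_norm_inv fun l => CInf.norm_fsmul_le _ _
  ⟨{ toFun := fun g => -∑' l : {l : Λ // l ≠ 0}, g l • ((l : Λ) : CInf F)⁻¹
     map_add' := fun g h => by
      rw [← neg_add, ← (hs g).tsum_add (hs h)]
      exact congrArg _ (tsum_congr fun l => by rw [LinearMap.add_apply, add_smul])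
     map_smul' := fun a g => by
      rw [RingHom.id_apply, smul_neg, Algebra.smul_def, ← tsum_mul_left]
      exact congrArg _ (tsum_congr fun l => by
        rw [← Algebra.smul_def, smul_smul, LinearMap.smul_apply, smul_eq_mul]) },
    (CInf.continuous_tsum (fun l : {l : Λ // l ≠ 0} =>
      continuous_dual_eval l.1 fun a => a • ((l : Λ) : CInf F)⁻¹)
      hΛ.tendsto_norm_inv fun _ _ => CInf.norm_fsmul_le _ _).neg⟩

end IsLattice

variable (F) in
/-- A Drinfeld `F[θ]`-module of rank `r` over `ℂ∞`: a ring homomorphism `a ↦ φ_a` from `F[θ]` to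
`ℂ∞[τ] ⊆ End_F(ℂ∞)` such that `φ_a` has degree `r deg a` in `τ` and constant term `a`. -/
structure DrinfeldModule (r : ℕ) where
  toRingHom : F[X] →+* Module.End F (CInf F)
  exists_coeff : ∀ a : F[X], a ≠ 0 → ∃ c : ℕ → CInf F, c 0 = algebraMap F[X] (CInf F) a ∧
    c (r * a.natDegree) ≠ 0 ∧
    ∀ x, toRingHom a x = ∑ i ∈ Finset.range (r * a.natDegree + 1), c i * x ^ (Nat.card F ^ i)

/-- `Λ` is the period lattice of `φ`: it is a lattice of rank `r` such that
`φ_a(exp_Λ(x)) = exp_Λ(a x)`. -/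
structure DrinfeldModule.IsPeriodLattice {r : ℕ} (φ : DrinfeldModule F r)
    (Λ : Submodule F[X] (CInf F)) : Prop extends IsLattice Λ where
  finrank_eq : Module.finrank F[X] Λ = r
  map_exp : ∀ (a : F[X]) (x : CInf F),
    φ.toRingHom a (expLattice Λ x) = expLattice Λ (algebraMap F[X] (CInf F) a * x)

end Universal

end

/-! A functional `h` on `Ω` is the residue against some `b ∈ K∞` without polynomial part, so `‖b‖ ≤
1/q`. Expanding the pairings at `h` gives `-∑ exp_Λ(bλ)/λ` for `ω` and `-∑ exp_Λ(bλ)^q/λ` for its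
twist, the sums running over `λ ≠ 0`. It is therefore enough that the first sum is `-b` and that the
second is `0` when `r ≥ 2`. The equation for `θ ⊗ 1 - 1 ⊗ θ` then only says that `θb` and the series
attached to `h ∘ θ` differ by the constant `h(dθ)`. Its solution is unique because elements of `ℂ∞
⊗̂ Ω` are bounded on the compact dual.

Both sums are first computed for a finite subspace `V` with `q^n` elements, `n ≥ 1`, in place of
`Λ`. There `exp_V(x) = ∑ e_i x^(q^i)`, and summing over `l` brings in the power sums `S_i = ∑ l^(q^i
- 1)`. One has `S_0 = -1`, and Lagrange interpolation gives `S_i = 0` for `0 < i < n`. Only the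
extreme terms survive, and their coefficients are found by taking `b = 1`, since `exp_V` vanishes on
`V`. The results are `-b + b^(q^n)` (`sum_exp_div`) and `ρ (b^(q^n) - b^(q^(n+1)))` with `ρ =
e_{n-1}^q / e_n` (`sum_exp_pow_div`).

The limit is taken along a flag of successive minima `w 0, w 1, …`. If `l` lies in `V` and `‖b‖ <
1`, the factors missing from `exp_V(bl)` have norm one, so `exp_V(bl)` has the same norm as
`exp_Λ(bl)`. That norm is bounded because `ω` is, and dominated convergence applies
(`tendsto_sum_exp_pow`). Since `b^(q^n) → 0`, the first sum is `-b`.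

For the second sum, `‖ρ‖ ≤ ‖exp_{V'}(w)‖^(q-1)`, where `V'` is the previous step of the flag and `w`
the vector added to it (`norm_coeffRatio_le`). In rank at least two the minima grow at most like
`q^(n/2)` (`norm_growth`), which forces this bound below `q^(3/4 * q^n)` for infinitely many `n`
(`exists_log_le_of_growth`). As `‖b‖^(q^n) ≤ q^(-q^n)`, a subsequence tends to `0`; the limit being
known to exist, it is `0`. -/

/-! ### Exponentials of finite subspaces -/

namespace FiniteSubspace

variable {F K : Type*} [Field F] [Field K] [Algebra F K]

/-- The elements of a finite subspace. -/
noncomputable def elems (V : Submodule F K) [Finite V] : Finset K :=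
  (Set.toFinite (V : Set K)).toFinset

@[simp] lemma mem_elems {V : Submodule F K} [Finite V] {x : K} : x ∈ elems V ↔ x ∈ V := by
  simp [elems]

lemma card_elems (V : Submodule F K) [Finite V] : (elems V).card = Nat.card V :=
  (Nat.card_eq_card_finite_toFinset _).symm

instance finite_sup_span [Finite F] (V : Submodule F K) [Finite V] (c : K) :
    Finite (V ⊔ Submodule.span F {c} : Submodule F K) :=
  Module.finite_of_finite F

open Classical in
lemma elems_sup_span [Fintype F] (V : Submodule F K) [Finite V] (c : K) :
    elems (V ⊔ Submodule.span F {c}) =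
      ((Finset.univ : Finset F) ×ˢ elems V).image fun p => p.1 • c + p.2 := by
  ext x
  simp only [mem_elems, Submodule.mem_sup, Submodule.mem_span_singleton, Finset.mem_image,
    Finset.mem_product, Finset.mem_univ, true_and, Prod.exists]
  constructor
  · rintro ⟨v, hv, _, ⟨a, rfl⟩, rfl⟩
    exact ⟨a, v, hv, add_comm _ _⟩
  · rintro ⟨a, v, hv, rfl⟩
    exact ⟨v, hv, _, ⟨a, rfl⟩, add_comm _ _⟩

lemma injective_smul_add (V : Submodule F K) {c : K} (hc : c ∉ V) {a a' : F} {v v' : K}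
    (hv : v ∈ V) (hv' : v' ∈ V) (h : a • c + v = a' • c + v') : a = a' ∧ v = v' := by
  have ha : a = a' := by
    by_contra hne
    have h1 : (a - a') • c ∈ V := by
      have : (a - a') • c = v' - v := by rw [sub_smul]; linear_combination h
      rw [this]; exact V.sub_mem hv' hv
    refine hc ?_
    have := V.smul_mem (a - a')⁻¹ h1
    rwa [smul_smul, inv_mul_cancel₀ (sub_ne_zero.2 hne), one_smul] at this
  subst ha
  exact ⟨rfl, add_left_cancel h⟩

lemma prod_elems_sup_span [Fintype F] {M : Type*} [CommMonoid M] (V : Submodule F K) [Finite V]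
    {c : K} (hc : c ∉ V) (g : K → M) :
    ∏ w ∈ elems (V ⊔ Submodule.span F {c}), g w = ∏ a : F, ∏ v ∈ elems V, g (a • c + v) := by
  classical
  rw [elems_sup_span, Finset.prod_image, Finset.prod_product]
  rintro ⟨a, v⟩ hv ⟨a', v'⟩ hv' h
  simp only [Finset.coe_product, Set.mem_prod, Finset.mem_coe, mem_elems] at hv hv'
  obtain ⟨rfl, rfl⟩ := injective_smul_add V hc hv.2 hv'.2 h
  rfl

lemma card_sup_span [Finite F] (V : Submodule F K) [Finite V] {c : K} (hc : c ∉ V) :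
    Nat.card (V ⊔ Submodule.span F {c} : Submodule F K) = Nat.card F * Nat.card V := by
  classical
  have := Fintype.ofFinite F
  rw [← card_elems, elems_sup_span, Finset.card_image_of_injOn, Finset.card_product, card_elems,
    Finset.card_univ, Nat.card_eq_fintype_card (α := F)]
  rintro ⟨a, v⟩ hv ⟨a', v'⟩ hv' h
  simp only [Finset.coe_product, Set.mem_prod, Finset.mem_coe, mem_elems] at hv hv'
  obtain ⟨rfl, rfl⟩ := injective_smul_add V hc hv.2 hv'.2 h
  rfl

open Classical in
lemma prod_erase_zero_sup_span [Fintype F] {M : Type*} [CommMonoid M] (V : Submodule F K)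
    [Finite V] {c : K} (hc : c ∉ V) (g : K → M) :
    ∏ w ∈ (elems (V ⊔ Submodule.span F {c})).erase 0, g w =
      (∏ w ∈ (elems V).erase 0, g w) *
        ∏ a ∈ (Finset.univ : Finset F).erase 0, ∏ v ∈ elems V, g (a • c + v) := by
  -- With the value at `0` replaced by `1`, products over nonzero elements become products over
  -- whole subspaces, which split into cosets of `V`.
  let f : K → M := fun w => if w = 0 then 1 else g w
  have key : ∀ S : Finset K, ∏ w ∈ S.erase 0, g w = ∏ w ∈ S, f w := by
    intro S
    rw [← Finset.prod_erase (f := f) (s := S) (a := 0) (by simp [f])]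
    exact Finset.prod_congr rfl fun w hw => by simp [f, (Finset.mem_erase.1 hw).1]
  rw [key, key, prod_elems_sup_span V hc, ← Finset.mul_prod_erase _ _ (Finset.mem_univ (0 : F))]
  simp only [zero_smul, zero_add]
  congr 1
  refine Finset.prod_congr rfl fun a ha => Finset.prod_congr rfl fun v hv => ?_
  refine if_neg fun h => (Finset.mem_erase.1 ha).1 ?_
  exact (injective_smul_add V hc (mem_elems.1 hv) V.zero_mem
    (h.trans (by simp : (0 : K) = (0 : F) • c + 0))).1

open Classical in
/-- `exp_V(x) = x ∏_{w ∈ V ∖ {0}} (1 - x / w)`, for a finite subspace `V`. -/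
noncomputable def exp (V : Submodule F K) [Finite V] (x : K) : K :=
  x * ∏ w ∈ (elems V).erase 0, (1 - x / w)

open Classical in
lemma exp_eq_prod (V : Submodule F K) [Finite V] (x : K) :
    exp V x = (∏ w ∈ elems V, (x - w)) * ∏ w ∈ (elems V).erase 0, (-w)⁻¹ := by
  have h0 : (0 : K) ∈ elems V := by simp
  rw [exp, ← Finset.mul_prod_erase _ _ h0, sub_zero, mul_assoc, ← Finset.prod_mul_distrib]
  congr 1
  refine Finset.prod_congr rfl fun w hw => ?_
  have := (Finset.mem_erase.1 hw).1
  field_simp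
  ring

lemma exp_add (V : Submodule F K) [Finite V] (x y : K) : exp V (x + y) = exp V x + exp V y := by
  rw [exp_eq_prod, exp_eq_prod, exp_eq_prod, ← add_mul, eval_prod_add _ (by simp)]
  intro x hx y hy
  simp only [mem_elems] at *
  exact V.sub_mem hx hy

lemma exp_smul (V : Submodule F K) [Finite V] (a : F) (x : K) : exp V (a • x) = a • exp V x := by
  classical
  by_cases ha : a = 0
  · simp [ha, exp]
  have ha' : algebraMap F K a ≠ 0 := by simpa using ha
  rw [exp, exp, smul_mul_assoc]
  congr 2
  refine (Finset.prod_nbij' (fun w => a • w) (fun w => a⁻¹ • w) ?_ ?_ ?_ ?_ ?_).symm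
  · intro w hw
    simp only [Finset.mem_erase, mem_elems] at hw ⊢
    exact ⟨smul_ne_zero ha hw.1, V.smul_mem _ hw.2⟩
  · intro w hw
    simp only [Finset.mem_erase, mem_elems] at hw ⊢
    exact ⟨smul_ne_zero (inv_ne_zero ha) hw.1, V.smul_mem _ hw.2⟩
  · intro w _; simp [smul_smul, inv_mul_cancel₀ ha]
  · intro w _; simp [smul_smul, mul_inv_cancel₀ ha]
  · intro w _
    rw [Algebra.smul_def, Algebra.smul_def, mul_div_mul_left _ _ ha']

lemma exp_eq_zero (V : Submodule F K) [Finite V] {x : K} (hx : x ∈ V) : exp V x = 0 := by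
  rw [exp_eq_prod, Finset.prod_eq_zero (mem_elems.2 hx) (sub_self x), zero_mul]

lemma exp_ne_zero (V : Submodule F K) [Finite V] {x : K} (hx : x ∉ V) : exp V x ≠ 0 := by
  classical
  rw [exp_eq_prod]
  refine mul_ne_zero (Finset.prod_ne_zero_iff.2 fun w hw h => hx ?_)
    (Finset.prod_ne_zero_iff.2 fun w hw => ?_)
  · rw [sub_eq_zero.1 h]; exact mem_elems.1 hw
  · simpa using (Finset.mem_erase.1 hw).1

open Classical in
-- This is `X ^ q - X = ∏ (X - a)` evaluated at `y⁻¹` and multiplied by a power of `y`; `a ↦ a⁻¹`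
-- permutes the nonzero scalars.
lemma prod_one_sub_div [Fintype F] (y : K) :
    ∏ a ∈ (Finset.univ : Finset F).erase 0, (1 - y / algebraMap F K a) =
      1 - y ^ (Nat.card F - 1) := by
  have hq : 1 < Fintype.card F := Fintype.one_lt_card
  have hq0 : Fintype.card F - 1 ≠ 0 := by omega
  rw [Nat.card_eq_fintype_card]
  by_cases hy : y = 0
  · simp [hy, hq0]
  have h1 : ∏ a : F, (X - C a) = X ^ Fintype.card F - X := by
    have := (splits_iff_card_roots (f := (X ^ Fintype.card F - X : F[X]))).2 (by
      rw [FiniteField.roots_X_pow_card_sub_X, FiniteField.X_pow_card_sub_X_natDegree_eq F hq]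
      rfl)
    have h2 := this.eq_prod_roots_of_monic (monic_X_pow_sub (by simp; omega))
    rw [h2, FiniteField.roots_X_pow_card_sub_X]
    rfl
  have h3 : y⁻¹ * ∏ a ∈ (Finset.univ : Finset F).erase 0, (y⁻¹ - algebraMap F K a) =
      y⁻¹ ^ Fintype.card F - y⁻¹ := by
    have := congrArg (aeval y⁻¹) h1
    rw [map_prod, ← Finset.mul_prod_erase _ _ (Finset.mem_univ (0 : F))] at this
    simpa using this
  have h4 : ∏ a ∈ (Finset.univ : Finset F).erase 0, (1 - y / algebraMap F K a) =
      ∏ a ∈ (Finset.univ : Finset F).erase 0, (y * (y⁻¹ - algebraMap F K a)) := by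
    refine Finset.prod_nbij' (fun a => a⁻¹) (fun a => a⁻¹) (by simp) (by simp) (by simp) (by simp)
      fun a ha => ?_
    rw [mul_sub, mul_inv_cancel₀ hy, map_inv₀, div_eq_mul_inv]
  rw [h4, Finset.prod_mul_distrib, Finset.prod_const, Finset.card_erase_of_mem (Finset.mem_univ _),
    Finset.card_univ]
  obtain ⟨n, hn⟩ : ∃ n, Fintype.card F = n + 1 := ⟨_, (Nat.sub_add_cancel hq.le).symm⟩
  rw [hn] at h3 ⊢
  rw [pow_succ', ← mul_sub_one, mul_right_inj' (inv_ne_zero hy)] at h3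
  rw [h3, Nat.add_sub_cancel, mul_sub, ← mul_pow, mul_inv_cancel₀ hy, one_pow, mul_one]

/-- The coset `a • c + V` contributes `exp_V(ac - x) / exp_V(ac)`, which is `1 - t / a` for `t =
exp_V(x) / exp_V(c)` by `F`-linearity. The product over `a ≠ 0` is `1 - t ^ (q - 1)`. -/
lemma exp_sup_span [Finite F] (V : Submodule F K) [Finite V] {c : K} (hc : c ∉ V) (x : K) :
    exp (V ⊔ Submodule.span F {c}) x =
      exp V x - exp V x ^ Nat.card F / exp V c ^ (Nat.card F - 1) := by
  classical
  have := Fintype.ofFinite F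
  have hE := exp_ne_zero V hc
  have hq : Nat.card F = (Nat.card F - 1) + 1 := by
    have := Finite.one_lt_card (α := F); omega
  have key : ∀ a ∈ (Finset.univ : Finset F).erase 0, ∏ v ∈ elems V, (1 - x / (a • c + v)) =
      1 - (exp V x / exp V c) / algebraMap F K a := by
    intro a ha
    have ha := (Finset.mem_erase.1 ha).1
    have ha' : algebraMap F K a ≠ 0 := by simpa using ha
    have hneg : ∀ y : K, ∏ v ∈ elems V, (y + v) = ∏ v ∈ elems V, (y - v) := fun y =>
      Finset.prod_nbij' (fun v => -v) (fun v => -v) (by simp) (by simp) (by simp) (by simp)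
        (by simp)
    have hne : ∀ v ∈ elems V, a • c + v ≠ 0 := fun v hv h => ha
      (injective_smul_add V hc (mem_elems.1 hv) V.zero_mem
        (h.trans (by simp : (0 : K) = (0 : F) • c + 0))).1
    have h1 : ∏ v ∈ elems V, (1 - x / (a • c + v)) =
        (∏ v ∈ elems V, (a • c - x - v)) / ∏ v ∈ elems V, (a • c - v) := by
      rw [← hneg, ← hneg, ← Finset.prod_div_distrib]
      refine Finset.prod_congr rfl fun v hv => ?_
      have := hne v hv
      field_simp
      ring
    have hk : ∏ w ∈ (elems V).erase 0, (-w)⁻¹ ≠ 0 := Finset.prod_ne_zero_iff.2 fun w hw => by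
      simpa using (Finset.mem_erase.1 hw).1
    rw [h1, ← mul_div_mul_right _ _ hk, ← exp_eq_prod, ← exp_eq_prod,
      show a • c - x = a • c + (-1 : F) • x by simp [sub_eq_add_neg], exp_add, exp_smul, exp_smul,
      Algebra.smul_def, neg_one_smul]
    field_simp
    ring
  rw [exp, prod_erase_zero_sup_span V hc, Finset.prod_congr rfl key, prod_one_sub_div, ← mul_assoc,
    ← exp, div_pow]
  nth_rewrite 3 [hq]
  rw [pow_succ]
  ring

/-! ### Power sums over a finite subspace -/

/-- The sum of the values of a polynomial of degree less than `|V| - 1` over `V` vanishes. -/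
lemma sum_eval_eq_zero (V : Submodule F K) [Finite V] {P : K[X]}
    (hP : P.natDegree + 1 < Nat.card V) : ∑ w ∈ elems V, P.eval w = 0 := by
  classical
  have hc := card_elems V
  -- Interpolation at the points of `V` expresses the coefficient of degree `|V| - 1`, here zero, as
  -- `∑ P(w) / ∏ (w - u)`. By translation invariance of `V` all the denominators agree.
  have h := Lagrange.coeff_eq_sum (s := elems V) (v := id) (Function.injective_id.injOn) (P := P)
    (lt_of_le_of_lt degree_le_natDegree (by rw [hc]; exact_mod_cast (by omega)))
  rw [hc, coeff_eq_zero_of_natDegree_lt (by omega)] at h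
  have hconst : ∀ w ∈ elems V, ∏ u ∈ (elems V).erase w, (w - u) = ∏ u ∈ (elems V).erase 0, u := by
    intro w hw
    rw [mem_elems] at hw
    refine Finset.prod_nbij' (fun u => w - u) (fun u => w - u) ?_ ?_ (by simp) (by simp) (by simp)
    · intro u hu
      simp only [Finset.mem_erase, mem_elems] at hu ⊢
      exact ⟨sub_ne_zero.2 hu.1.symm, V.sub_mem hw hu.2⟩
    · intro u hu
      simp only [Finset.mem_erase, mem_elems] at hu ⊢
      exact ⟨by simpa using hu.1, V.sub_mem hw hu.2⟩
  have h2 : (0 : K) = ∑ w ∈ elems V, P.eval w / ∏ u ∈ (elems V).erase 0, u :=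
    h.trans (Finset.sum_congr rfl fun w hw => by simp only [id]; rw [hconst w hw])
  rw [← Finset.sum_div] at h2
  refine (div_eq_zero_iff.1 h2.symm).resolve_right (Finset.prod_ne_zero_iff.2 fun w hw => ?_)
  exact (Finset.mem_erase.1 hw).1

open Classical in
/-- The sum of the `(n - 1)`-st powers of the nonzero elements of `V`. -/
noncomputable def powerSum (V : Submodule F K) [Finite V] (n : ℕ) : K :=
  ∑ w ∈ (elems V).erase 0, w ^ n / w

/-- Every summand is `1`, and the number `q ^ (d + 1) - 1` of summands is `-1` in characteristic
dividing `q`. -/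
lemma powerSum_one [Finite F] (V : Submodule F K) [Finite V] {d : ℕ}
    (hd : Nat.card V = Nat.card F ^ (d + 1)) : powerSum V 1 = -1 := by
  classical
  have := Fintype.ofFinite F
  have h : powerSum V 1 = ∑ w ∈ (elems V).erase 0, (1 : K) :=
    Finset.sum_congr rfl fun w hw => by
      rw [pow_one, div_self (Finset.mem_erase.1 hw).1]
  have h0 : ((Nat.card F : ℕ) : K) = 0 := by
    rw [Nat.card_eq_fintype_card, ← map_natCast (algebraMap F K), FiniteField.cast_card_eq_zero,
      map_zero]
  have h1 := Finset.add_sum_erase (elems V) (fun _ => (1 : K)) (show (0 : K) ∈ elems V by simp)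
  rw [← h, Finset.sum_const, card_elems, hd, nsmul_one, Nat.cast_pow, h0,
    zero_pow (by omega)] at h1
  linear_combination h1

lemma powerSum_eq_zero [Finite F] (V : Submodule F K) [Finite V] {d i : ℕ}
    (hd : Nat.card V = Nat.card F ^ d) (hi : i + 1 < d) :
    powerSum V (Nat.card F ^ (i + 1)) = 0 := by
  classical
  have hq := Finite.one_lt_card (α := F)
  have h1 : 1 < Nat.card F ^ (i + 1) := Nat.one_lt_pow (by omega) hq
  have h2 : Nat.card F ^ (i + 1) < Nat.card F ^ d := Nat.pow_lt_pow_right hq hi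
  have h := sum_eval_eq_zero V (P := X ^ (Nat.card F ^ (i + 1) - 1)) (by
    rw [natDegree_X_pow, hd]; omega)
  rw [← Finset.add_sum_erase _ _ (show (0 : K) ∈ elems V by simp)] at h
  simp only [eval_pow, eval_X] at h
  -- The exponent `q ^ (i + 1) - 1` is positive, so `0` contributes nothing to the sum over all of
  -- `V`.
  rw [zero_pow (by omega), zero_add] at h
  refine Eq.trans (Finset.sum_congr rfl fun w hw => ?_) h
  have := (Finset.mem_erase.1 hw).1
  rw [div_eq_iff this, ← pow_succ, Nat.sub_add_cancel h1.le]

end FiniteSubspace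

/-! ### Coefficients of the exponentials along a flag, and the finite sums -/

namespace FiniteSubspace

variable {F K : Type*} [Field F] [Finite F] [Field K] [Algebra F K]

variable (F) in
/-- The span of `w 0, …, w (d - 1)`. -/
def flag (w : ℕ → K) : ℕ → Submodule F K
  | 0 => ⊥
  | d + 1 => flag w d ⊔ Submodule.span F {w d}

instance finite_flag (w : ℕ → K) (d : ℕ) : Finite (flag F w d) := by
  induction d with
  | zero => exact inferInstanceAs (Finite (⊥ : Submodule F K))
  | succ d ih => exact finite_sup_span (flag F w d) (w d)

lemma flag_mono (w : ℕ → K) : Monotone (flag F w) :=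
  monotone_nat_of_le_succ fun _ => le_sup_left

lemma mem_flag_succ (w : ℕ → K) (d : ℕ) : w d ∈ flag F w (d + 1) :=
  Submodule.mem_sup_right (Submodule.mem_span_singleton_self _)

variable {w : ℕ → K}

lemma card_flag (hw : ∀ d, w d ∉ flag F w d) (d : ℕ) :
    Nat.card (flag F w d) = Nat.card F ^ d := by
  induction d with
  | zero => exact Nat.card_unique (α := (⊥ : Submodule F K))
  | succ d ih =>
    rw [pow_succ', ← ih]
    exact card_sup_span (flag F w d) (hw d)

variable (F) in
/-- The coefficient at `x ^ (q ^ i)` of the exponential of the `d`-th step of a flag. -/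
noncomputable def expCoeff (w : ℕ → K) : ℕ → ℕ → K
  | 0, 0 => 1
  | 0, _ + 1 => 0
  | _ + 1, 0 => 1
  | d + 1, i + 1 => expCoeff w d (i + 1) -
      expCoeff w d i ^ Nat.card F / exp (flag F w d) (w d) ^ (Nat.card F - 1)

lemma expCoeff_zero (d : ℕ) : expCoeff F w d 0 = 1 := by
  cases d <;> simp [expCoeff]

lemma expCoeff_eq_zero {d i : ℕ} (h : d < i) : expCoeff F w d i = 0 := by
  induction d generalizing i with
  | zero =>
    obtain ⟨i, rfl⟩ := Nat.exists_eq_succ_of_ne_zero h.ne'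
    simp [expCoeff]
  | succ d ih =>
    obtain ⟨i, rfl⟩ := Nat.exists_eq_succ_of_ne_zero (by omega : i ≠ 0)
    have : Nat.card F ≠ 0 := Nat.card_pos.ne'
    rw [expCoeff, ih (by omega), ih (by omega), zero_pow this, zero_div, sub_zero]

variable (F) in
lemma sum_pow_card {ι : Type*} (s : Finset ι) (f : ι → K) :
    (∑ i ∈ s, f i) ^ Nat.card F = ∑ i ∈ s, f i ^ Nat.card F := by
  have := Fintype.ofFinite F
  rw [Nat.card_eq_fintype_card]
  exact map_sum (FiniteField.frobeniusAlgHom F K) f s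

/-- The recursion defining `expCoeff` is `exp_sup_span` read off coefficient by coefficient, since
raising to the power `q` is additive. -/
lemma exp_flag (hw : ∀ d, w d ∉ flag F w d) (d : ℕ) (x : K) :
    exp (flag F w d) x =
      ∑ i ∈ Finset.range (d + 1), expCoeff F w d i * x ^ (Nat.card F ^ i) := by
  induction d with
  | zero =>
    classical
    have : (elems (flag F w 0)).erase 0 = ∅ := by
      ext y
      simp only [Finset.mem_erase, mem_elems, flag, Submodule.mem_bot, Finset.notMem_empty,
        iff_false, not_and]
      exact fun h h' => h h'
    simp [exp, this, expCoeff]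
  | succ d ih =>
    have h := exp_sup_span (flag F w d) (hw d) x
    change exp (flag F w (d + 1)) x = _ at h
    rw [h, Finset.sum_range_succ']
    simp only [expCoeff, sub_mul, Finset.sum_sub_distrib]
    have h1 : exp (flag F w d) x =
        ∑ i ∈ Finset.range (d + 1), expCoeff F w d (i + 1) * x ^ (Nat.card F ^ (i + 1)) + x := by
      have h2 := Finset.sum_range_succ' (fun i => expCoeff F w d i * x ^ (Nat.card F ^ i)) (d + 1)
      rw [Finset.sum_range_succ, ← ih, expCoeff_eq_zero (Nat.lt_succ_self d), zero_mul, add_zero,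
        expCoeff_zero] at h2
      simpa using h2
    have h3 : exp (flag F w d) x ^ Nat.card F = ∑ i ∈ Finset.range (d + 1),
        expCoeff F w d i ^ Nat.card F * x ^ (Nat.card F ^ (i + 1)) := by
      rw [ih, sum_pow_card F]
      exact Finset.sum_congr rfl fun i _ => by rw [mul_pow, ← pow_mul, pow_succ]
    rw [h3, Finset.sum_div, pow_zero, pow_one, one_mul]
    nth_rewrite 1 [h1]
    rw [add_sub_right_comm]
    congr 2
    exact Finset.sum_congr rfl fun i _ => by ring

open Classical in
lemma sum_mul_pow_div (V : Submodule F K) [Finite V] (n : ℕ) (f : ℕ → K) (k : ℕ → ℕ) :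
    ∑ l ∈ (elems V).erase 0, (∑ i ∈ Finset.range n, f i * l ^ k i) / l =
      ∑ i ∈ Finset.range n, f i * powerSum V (k i) := by
  simp only [Finset.sum_div, powerSum, Finset.mul_sum]
  rw [Finset.sum_comm]
  exact Finset.sum_congr rfl fun i _ => Finset.sum_congr rfl fun l _ => by ring

lemma sum_range_mul_powerSum (hw : ∀ d, w d ∉ flag F w d) (d : ℕ) (f : ℕ → K) :
    ∑ i ∈ Finset.range (d + 2), f i * powerSum (flag F w (d + 1)) (Nat.card F ^ i) =
      -f 0 + f (d + 1) * powerSum (flag F w (d + 1)) (Nat.card F ^ (d + 1)) := by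
  rw [Finset.sum_range_succ, Finset.sum_range_succ', Finset.sum_eq_zero, pow_zero,
    powerSum_one _ (card_flag hw (d + 1))]
  · ring
  · intro i hi
    rw [powerSum_eq_zero _ (card_flag hw (d + 1)) (by simpa using hi), mul_zero]

/-- The twist shifts the exponents by one step: the term with power sum `-1` disappears, and the
power sum just above the vanishing range enters in addition. -/
lemma sum_range_mul_powerSum_succ (hw : ∀ d, w d ∉ flag F w d) (d : ℕ) (f : ℕ → K) :
    ∑ i ∈ Finset.range (d + 2), f i * powerSum (flag F w (d + 1)) (Nat.card F ^ (i + 1)) =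
      f d * powerSum (flag F w (d + 1)) (Nat.card F ^ (d + 1)) +
      f (d + 1) * powerSum (flag F w (d + 1)) (Nat.card F ^ (d + 2)) := by
  rw [Finset.sum_range_succ, Finset.sum_range_succ, Finset.sum_eq_zero, zero_add]
  intro i hi
  rw [powerSum_eq_zero _ (card_flag hw (d + 1)) (by simpa using hi), mul_zero]

/-- This is the case `b = 1` of the sum `∑ exp(bl) / l`, all of whose terms vanish. -/
lemma expCoeff_mul_powerSum (hw : ∀ d, w d ∉ flag F w d) (d : ℕ) :
    expCoeff F w (d + 1) (d + 1) * powerSum (flag F w (d + 1)) (Nat.card F ^ (d + 1)) = 1 := by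
  classical
  have h := sum_mul_pow_div (flag F w (d + 1)) (d + 2) (expCoeff F w (d + 1))
    fun i => Nat.card F ^ i
  rw [sum_range_mul_powerSum hw, Finset.sum_eq_zero, expCoeff_zero] at h
  · linear_combination -h
  · intro l hl
    rw [← exp_flag hw, exp_eq_zero _ (mem_elems.1 (Finset.mem_erase.1 hl).2), zero_div]

/-- The same argument for `∑ exp(l) ^ q / l`. It eliminates the power sum of exponent `q ^ (d + 2)`,
which is not computed otherwise. -/
lemma expCoeff_pow_mul_powerSum (hw : ∀ d, w d ∉ flag F w d) (d : ℕ) :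
    expCoeff F w (d + 1) d ^ Nat.card F *
        powerSum (flag F w (d + 1)) (Nat.card F ^ (d + 1)) +
      expCoeff F w (d + 1) (d + 1) ^ Nat.card F *
        powerSum (flag F w (d + 1)) (Nat.card F ^ (d + 2)) = 0 := by
  classical
  have h := sum_mul_pow_div (flag F w (d + 1)) (d + 2)
    (fun i => expCoeff F w (d + 1) i ^ Nat.card F) fun i => Nat.card F ^ (i + 1)
  rw [sum_range_mul_powerSum_succ hw, Finset.sum_eq_zero] at h
  · exact h.symm
  · intro l hl
    have h1 := congrArg (· ^ Nat.card F) (exp_flag hw (d + 1) l)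
    simp only [sum_pow_card F, mul_pow, ← pow_mul, ← pow_succ] at h1
    rw [← h1, exp_eq_zero _ (mem_elems.1 (Finset.mem_erase.1 hl).2), zero_pow Nat.card_pos.ne',
      zero_div]

open Classical in
theorem sum_exp_div (hw : ∀ d, w d ∉ flag F w d) (d : ℕ) (b : K) :
    ∑ l ∈ (elems (flag F w (d + 1))).erase 0, exp (flag F w (d + 1)) (b * l) / l =
      -b + b ^ (Nat.card F ^ (d + 1)) := by
  have h := sum_mul_pow_div (flag F w (d + 1)) (d + 2)
    (fun i => expCoeff F w (d + 1) i * b ^ (Nat.card F ^ i)) fun i => Nat.card F ^ i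
  rw [sum_range_mul_powerSum hw, expCoeff_zero, pow_zero, pow_one, one_mul, mul_right_comm,
    expCoeff_mul_powerSum hw, one_mul] at h
  rw [← h]
  exact Finset.sum_congr rfl fun l _ => by simp only [exp_flag hw, mul_pow, mul_assoc]

variable (F) in
/-- The ratio `e_d ^ q / e_{d + 1}` of the two leading coefficients of the exponential of the
`(d + 1)`-st step of a flag. -/
noncomputable def coeffRatio (w : ℕ → K) (d : ℕ) : K :=
  expCoeff F w (d + 1) d ^ Nat.card F / expCoeff F w (d + 1) (d + 1)

open Classical in
theorem sum_exp_pow_div (hw : ∀ d, w d ∉ flag F w d) (d : ℕ) (b : K) :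
    ∑ l ∈ (elems (flag F w (d + 1))).erase 0,
        exp (flag F w (d + 1)) (b * l) ^ Nat.card F / l =
      coeffRatio F w d * (b ^ (Nat.card F ^ (d + 1)) - b ^ (Nat.card F ^ (d + 2))) := by
  have h := sum_mul_pow_div (flag F w (d + 1)) (d + 2)
    (fun i => expCoeff F w (d + 1) i ^ Nat.card F * b ^ (Nat.card F ^ (i + 1)))
    fun i => Nat.card F ^ (i + 1)
  rw [sum_range_mul_powerSum_succ hw] at h
  have h1 := expCoeff_mul_powerSum hw d
  have h2 := expCoeff_pow_mul_powerSum hw d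
  have h3 : coeffRatio F w d = expCoeff F w (d + 1) d ^ Nat.card F *
      powerSum (flag F w (d + 1)) (Nat.card F ^ (d + 1)) := by
    rw [coeffRatio, div_eq_mul_inv, inv_eq_of_mul_eq_one_right h1]
  rw [h3]
  trans ∑ l ∈ (elems (flag F w (d + 1))).erase 0, (∑ i ∈ Finset.range (d + 2),
    expCoeff F w (d + 1) i ^ Nat.card F * b ^ (Nat.card F ^ (i + 1)) *
      l ^ Nat.card F ^ (i + 1)) / l
  · refine Finset.sum_congr rfl fun l _ => ?_
    simp only [exp_flag hw, sum_pow_card F, mul_pow, ← pow_mul, ← pow_succ, mul_assoc]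
  · rw [h]
    linear_combination b ^ (Nat.card F ^ (d + 2)) * h2

lemma coeffRatio_zero (hw : ∀ d, w d ∉ flag F w d) :
    coeffRatio F w 0 = -exp (flag F w 0) (w 0) ^ (Nat.card F - 1) := by
  have := exp_ne_zero _ (hw 0)
  simp only [coeffRatio, expCoeff, one_pow, zero_sub]
  field_simp

/-- In the recursion for `expCoeff`, the top coefficient comes from the Frobenius term alone and the
next one from both terms. Dividing, the top coefficient of the previous step cancels. -/
lemma coeffRatio_succ (hw : ∀ d, w d ∉ flag F w d) (d : ℕ) :
    coeffRatio F w (d + 1) = -exp (flag F w (d + 1)) (w (d + 1)) ^ (Nat.card F - 1) *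
      (1 - coeffRatio F w d / exp (flag F w (d + 1)) (w (d + 1)) ^ (Nat.card F - 1)) ^
        Nat.card F := by
  have hv := pow_ne_zero (Nat.card F - 1) (exp_ne_zero _ (hw (d + 1)))
  have hf : expCoeff F w (d + 1) (d + 1) ≠ 0 := left_ne_zero_of_mul_eq_one
    (expCoeff_mul_powerSum hw d)
  have h1 : expCoeff F w (d + 2) (d + 2) = -(expCoeff F w (d + 1) (d + 1) ^ Nat.card F /
      exp (flag F w (d + 1)) (w (d + 1)) ^ (Nat.card F - 1)) := by
    rw [expCoeff, expCoeff_eq_zero (Nat.lt_succ_self _), zero_sub]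
  have h2 : expCoeff F w (d + 2) (d + 1) = expCoeff F w (d + 1) (d + 1) *
      (1 - coeffRatio F w d / exp (flag F w (d + 1)) (w (d + 1)) ^ (Nat.card F - 1)) := by
    rw [expCoeff, coeffRatio]
    field_simp
  have h3 : coeffRatio F w (d + 1) = expCoeff F w (d + 2) (d + 1) ^ Nat.card F /
    expCoeff F w (d + 2) (d + 2) := rfl
  rw [h3, h1, h2, mul_pow]
  have := pow_ne_zero (Nat.card F) hf
  field_simp

end FiniteSubspace

/-! ### Flags of successive minima -/

namespace IsLattice

open FiniteSubspace

variable {F : Type*} [Field F] [Finite F] {Λ : Submodule F[X] (CInf F)}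

lemma exists_minimal_notMem (hΛ : IsLattice Λ) (hinf : (Λ : Set (CInf F)).Infinite)
    (V : Submodule F (CInf F)) [Finite V] :
    ∃ w ∈ Λ, w ∉ V ∧ ∀ l ∈ Λ, l ∉ V → ‖w‖ ≤ ‖l‖ := by
  obtain ⟨l₀, hl₀, hV₀⟩ := hinf.exists_notMem_finite (Set.toFinite (V : Set (CInf F)))
  have hfin : {x : CInf F | (x ∈ Λ ∧ ‖x‖ ≤ ‖l₀‖) ∧ x ∉ V}.Finite :=
    (hΛ.finite_ball ‖l₀‖).subset fun x hx => hx.1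
  obtain ⟨w, hw, hmin⟩ := Set.exists_min_image _ (fun x => ‖x‖) hfin ⟨l₀, ⟨hl₀, le_rfl⟩, hV₀⟩
  refine ⟨w, hw.1.1, hw.2, fun l hl hlV => ?_⟩
  rcases le_total ‖l‖ ‖l₀‖ with h | h
  · exact hmin l ⟨⟨hl, h⟩, hlV⟩
  · exact hw.1.2.trans h

/-- `w d` is an element of minimal norm of `Λ` outside of the span of `w 0, …, w (d - 1)`. -/
structure IsMinimalFlag (Λ : Submodule F[X] (CInf F)) (w : ℕ → CInf F) : Prop where
  mem : ∀ d, w d ∈ Λ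
  notMem : ∀ d, w d ∉ flag F w d
  norm_le : ∀ d, ∀ l ∈ Λ, l ∉ flag F w d → ‖w d‖ ≤ ‖l‖

lemma exists_isMinimalFlag (hΛ : IsLattice Λ) (hinf : (Λ : Set (CInf F)).Infinite) :
    ∃ w, IsMinimalFlag Λ w := by
  choose next h1 h2 h3 using fun V : {V : Submodule F (CInf F) // Finite V} =>
    haveI := V.2; hΛ.exists_minimal_notMem hinf V.1
  -- Finiteness is carried along in the recursion, because the choice of the next vector depends on
  -- it.
  let S : ℕ → {V : Submodule F (CInf F) // Finite V} := fun d => Nat.rec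
    ⟨⊥, inferInstance⟩ (fun _ V => ⟨V.1 ⊔ Submodule.span F {next V},
      haveI := V.2; finite_sup_span V.1 (next V)⟩) d
  have hS : ∀ d, flag F (fun d => next (S d)) d = (S d).1 := by
    intro d
    induction d with
    | zero => rfl
    | succ d ih =>
      change flag F (fun d => next (S d)) d ⊔ _ = _
      rw [ih]
  refine ⟨fun d => next (S d), fun d => h1 _, fun d => ?_, fun d => ?_⟩
  · rw [hS]; exact h2 _
  · rw [hS]; exact h3 _

namespace IsMinimalFlag

variable {w : ℕ → CInf F}

lemma flag_subset (hw : IsMinimalFlag Λ w) {d : ℕ} {x : CInf F} (hx : x ∈ flag F w d) : x ∈ Λ := by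
  have hle : ∀ d, flag F w d ≤ Λ.restrictScalars F := by
    intro d
    induction d with
    | zero => exact bot_le
    | succ d ih =>
      refine sup_le ih ?_
      rw [Submodule.span_singleton_le_iff_mem]
      exact hw.mem d
  exact hle d hx

lemma norm_mono (hw : IsMinimalFlag Λ w) : Monotone fun d => ‖w d‖ :=
  monotone_nat_of_le_succ fun d => hw.norm_le d _ (hw.mem _) fun h =>
    hw.notMem (d + 1) (flag_mono w d.le_succ h)

lemma norm_pos (hw : IsMinimalFlag Λ w) (d : ℕ) : 0 < ‖w d‖ :=
  norm_pos_iff.2 fun h => hw.notMem d (h ▸ Submodule.zero_mem _)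

lemma norm_le_of_mem (hw : IsMinimalFlag Λ w) {d : ℕ} {x : CInf F}
    (hx : x ∈ flag F w (d + 1)) : ‖x‖ ≤ ‖w d‖ := by
  induction d generalizing x with
  | zero =>
    obtain ⟨v, hv, y, hy, rfl⟩ := Submodule.mem_sup.1 hx
    obtain ⟨a, rfl⟩ := Submodule.mem_span_singleton.1 hy
    rw [(Submodule.mem_bot F).1 hv, zero_add]
    exact CInf.norm_fsmul_le _ _
  | succ d ih =>
    obtain ⟨v, hv, y, hy, rfl⟩ := Submodule.mem_sup.1 hx
    obtain ⟨a, rfl⟩ := Submodule.mem_span_singleton.1 hy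
    exact (IsUltrametricDist.norm_add_le_max _ _).trans
      (max_le ((ih hv).trans (hw.norm_mono d.le_succ)) (CInf.norm_fsmul_le _ _))

lemma norm_eq (hw : IsMinimalFlag Λ w) {d : ℕ} {x : CInf F}
    (hx : x ∈ flag F w (d + 1)) (hx' : x ∉ flag F w d) : ‖x‖ = ‖w d‖ :=
  (hw.norm_le_of_mem hx).antisymm (hw.norm_le d x (hw.flag_subset hx) hx')

/-- A lattice point outside every step would bound the norms of all the `w d`, which are infinitely
many distinct lattice points. -/
lemma exists_mem_flag (hΛ : IsLattice Λ) (hw : IsMinimalFlag Λ w) {x : CInf F} (hx : x ∈ Λ) :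
    ∃ d, x ∈ flag F w d := by
  by_contra! h
  have hinj : Function.Injective w := by
    have hlt : ∀ i j, i < j → w i ≠ w j := fun i j hij he => hw.notMem j (he ▸
      flag_mono w (Nat.succ_le_of_lt hij) (mem_flag_succ w i))
    intro i j he
    by_contra hne
    rcases lt_or_gt_of_ne hne with h | h
    · exact hlt i j h he
    · exact hlt j i h he.symm
  exact Set.infinite_range_of_injective hinj ((hΛ.finite_ball ‖x‖).subset (by
    rintro _ ⟨d, rfl⟩
    exact ⟨hw.mem d, hw.norm_le d x hx (h d)⟩))

lemma injective_val : Function.Injective fun l : {l : Λ // l ≠ 0} => ((l : Λ) : CInf F) :=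
  Subtype.val_injective.comp Subtype.val_injective

/-- The nonzero lattice points in the `d`-th step of the flag. -/
noncomputable def points (Λ : Submodule F[X] (CInf F)) (w : ℕ → CInf F) (d : ℕ) :
    Finset {l : Λ // l ≠ 0} :=
  (elems (flag F w d)).preimage (fun l => ((l : Λ) : CInf F)) injective_val.injOn

lemma mem_points {d : ℕ} {l : {l : Λ // l ≠ 0}} :
    l ∈ points Λ w d ↔ ((l : Λ) : CInf F) ∈ flag F w d := by
  simp [points]

open Classical in
lemma prod_points (hw : IsMinimalFlag Λ w) (d : ℕ) {M : Type*} [CommMonoid M] (g : CInf F → M) :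
    ∏ l ∈ points Λ w d, g ((l : Λ) : CInf F) = ∏ x ∈ (elems (flag F w d)).erase 0, g x := by
  refine Finset.prod_bij (fun l _ => ((l : Λ) : CInf F)) ?_ ?_ ?_ ?_
  · intro l hl
    rw [Finset.mem_erase, mem_elems]
    exact ⟨fun h => l.2 (Subtype.ext h), mem_points.1 hl⟩
  · intro l _ m _ h
    exact injective_val h
  · intro x hx
    rw [Finset.mem_erase, mem_elems] at hx
    exact ⟨⟨⟨x, hw.flag_subset hx.2⟩, fun h => hx.1 (congrArg Subtype.val h)⟩,
      mem_points.2 hx.2, rfl⟩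
  · intros; rfl

open Classical in
lemma sum_points (hw : IsMinimalFlag Λ w) (d : ℕ) (g : CInf F → CInf F) :
    ∑ l ∈ points Λ w d, g ((l : Λ) : CInf F) = ∑ x ∈ (elems (flag F w d)).erase 0, g x :=
  -- The additive statement is the multiplicative one in `Multiplicative (CInf F)`.
  hw.prod_points d (M := Multiplicative (CInf F)) fun x => Multiplicative.ofAdd (g x)

lemma tendsto_points (hΛ : IsLattice Λ) (hw : IsMinimalFlag Λ w) :
    Tendsto (points Λ w) atTop atTop := by
  refine tendsto_atTop_finset_of_monotone (fun m n hmn l hl => ?_) fun l => ?_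
  · exact mem_points.2 (flag_mono w hmn (mem_points.1 hl))
  · obtain ⟨d, hd⟩ := hw.exists_mem_flag hΛ l.1.2
    exact ⟨d, mem_points.2 hd⟩

lemma tendsto_exp_flag (hΛ : IsLattice Λ) (hw : IsMinimalFlag Λ w) (x : CInf F) :
    Tendsto (fun d => exp (flag F w d) x) atTop (𝓝 (expLattice Λ x)) := by
  refine (((CInf.multipliable_one_sub (hΛ.tendsto_div x)).hasProd.comp
    (hw.tendsto_points hΛ)).const_mul x).congr fun d => ?_
  exact congrArg _ (hw.prod_points d fun l => 1 - x / l)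

/-! ### Norms of the exponentials along a minimal flag -/

lemma norm_exp_flag_eq (hw : IsMinimalFlag Λ w) {d : ℕ} {x : CInf F} (hx : ‖x‖ < ‖w d‖) {D : ℕ}
    (hD : d ≤ D) : ‖exp (flag F w D) x‖ = ‖exp (flag F w d) x‖ := by
  classical
  have hsub : (elems (flag F w d)).erase 0 ⊆ (elems (flag F w D)).erase 0 :=
    Finset.erase_subset_erase _ fun y hy => mem_elems.2 (flag_mono w hD (mem_elems.1 hy))
  rw [exp, exp, norm_mul, norm_mul, ← Finset.prod_sdiff hsub, norm_mul, norm_prod,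
    Finset.prod_eq_one, one_mul]
  intro l hl
  have hl1 := Finset.mem_erase.1 (Finset.mem_sdiff.1 hl).1
  have hl2 : l ∉ flag F w d := fun h =>
    (Finset.mem_sdiff.1 hl).2 (Finset.mem_erase.2 ⟨hl1.1, mem_elems.2 h⟩)
  have hlt : ‖x / l‖ < 1 := by
    rw [norm_div, div_lt_one (norm_pos_iff.2 hl1.1)]
    exact hx.trans_le (hw.norm_le d l (hw.flag_subset (mem_elems.1 hl1.2)) hl2)
  rw [sub_eq_add_neg, IsUltrametricDist.norm_add_eq_max_of_norm_ne_norm]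
  · simpa using hlt.le
  · simpa using hlt.ne'

lemma norm_expLattice_eq (hΛ : IsLattice Λ) (hw : IsMinimalFlag Λ w) {d : ℕ} {x : CInf F}
    (hx : ‖x‖ < ‖w d‖) : ‖expLattice Λ x‖ = ‖exp (flag F w d) x‖ := by
  refine tendsto_nhds_unique (hw.tendsto_exp_flag hΛ x).norm (tendsto_nhds_of_eventually_eq ?_)
  filter_upwards [eventually_ge_atTop d] with D hD
  exact hw.norm_exp_flag_eq hx hD

open Classical in
-- By minimality every element of the coset `w d - flag F w d` has norm `‖w d‖`.
lemma norm_exp_flag_self (hw : IsMinimalFlag Λ w) (d : ℕ) :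
    ‖exp (flag F w d) (w d)‖ =
      ‖w d‖ ^ (Nat.card F ^ d) * ∏ x ∈ (elems (flag F w d)).erase 0, ‖x‖⁻¹ := by
  rw [exp_eq_prod, norm_mul, norm_prod, norm_prod]
  congr 1
  · rw [← card_flag hw.notMem d, ← card_elems]
    refine Finset.prod_eq_pow_card fun x hx => ?_
    rw [mem_elems] at hx
    refine hw.norm_eq (Submodule.sub_mem _ (mem_flag_succ w d) (flag_mono w d.le_succ hx))
      fun h => hw.notMem d ?_
    simpa using Submodule.add_mem _ h hx
  · exact Finset.prod_congr rfl fun x _ => by simp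

/-- Passing to the next step adds `q ^ d * (q - 1)` points, all of norm `‖w d‖`. Together with the
factor `‖w d‖ ^ (q ^ d)` already present they account for the exponent `q ^ (d + 1)`. -/
lemma norm_exp_flag_succ (hw : IsMinimalFlag Λ w) (d : ℕ) :
    ‖exp (flag F w (d + 1)) (w (d + 1))‖ =
      ‖exp (flag F w d) (w d)‖ * (‖w (d + 1)‖ / ‖w d‖) ^ (Nat.card F ^ (d + 1)) := by
  classical
  have := Fintype.ofFinite F
  have hne := (hw.norm_pos d).ne'
  have h := prod_erase_zero_sup_span (flag F w d) (hw.notMem d) fun x => ‖x‖⁻¹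
  change ∏ x ∈ (elems (flag F w (d + 1))).erase 0, ‖x‖⁻¹ = _ at h
  have h2 : ∏ a ∈ (Finset.univ : Finset F).erase 0, ∏ v ∈ elems (flag F w d),
      ‖a • w d + v‖⁻¹ = (‖w d‖⁻¹) ^ (Nat.card F ^ d * (Nat.card F - 1)) := by
    rw [pow_mul, Nat.card_eq_fintype_card (α := F), ← Finset.card_univ (α := F),
      ← Finset.card_erase_of_mem (Finset.mem_univ (0 : F))]
    refine Finset.prod_eq_pow_card fun a ha => ?_
    rw [Finset.card_univ, ← Nat.card_eq_fintype_card, ← card_flag hw.notMem d, ← card_elems]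
    refine Finset.prod_eq_pow_card fun v hv => ?_
    rw [mem_elems] at hv
    rw [hw.norm_eq]
    · exact Submodule.add_mem _ (Submodule.smul_mem _ _ (mem_flag_succ w d))
        (flag_mono w d.le_succ hv)
    · intro hmem
      have h3 := Submodule.sub_mem _ hmem hv
      rw [add_sub_cancel_right] at h3
      have h4 := Submodule.smul_mem _ a⁻¹ h3
      rw [smul_smul, inv_mul_cancel₀ (Finset.mem_erase.1 ha).1, one_smul] at h4
      exact hw.notMem d h4
  rw [norm_exp_flag_self hw, norm_exp_flag_self hw, h, h2, div_pow]
  have hq : Nat.card F ^ (d + 1) = Nat.card F ^ d + Nat.card F ^ d * (Nat.card F - 1) := by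
    have := Finite.one_lt_card (α := F)
    obtain ⟨n, hn⟩ : ∃ n, Nat.card F = n + 1 := ⟨_, (Nat.sub_add_cancel this.le).symm⟩
    rw [hn, Nat.add_sub_cancel]; ring
  have h5 : ‖w d‖ ^ (Nat.card F ^ (d + 1)) =
      ‖w d‖ ^ (Nat.card F ^ d) * ‖w d‖ ^ (Nat.card F ^ d * (Nat.card F - 1)) := by
    rw [hq, pow_add]
  rw [h5, inv_pow]
  field_simp

lemma norm_exp_flag_le_succ (hw : IsMinimalFlag Λ w) (d : ℕ) :
    ‖exp (flag F w d) (w d)‖ ≤ ‖exp (flag F w (d + 1)) (w (d + 1))‖ := by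
  rw [norm_exp_flag_succ hw]
  exact le_mul_of_one_le_right (norm_nonneg _)
    (one_le_pow₀ ((one_le_div (hw.norm_pos d)).2 (hw.norm_mono d.le_succ)))

/-- Since `‖exp(w d)‖` is nondecreasing in `d`, the factor `1 - …` in `coeffRatio_succ` stays of
norm at most one. -/
lemma norm_coeffRatio_le (hw : IsMinimalFlag Λ w) (d : ℕ) :
    ‖coeffRatio F w d‖ ≤ ‖exp (flag F w d) (w d)‖ ^ (Nat.card F - 1) := by
  induction d with
  | zero => rw [coeffRatio_zero hw.notMem, norm_neg, norm_pow]
  | succ d ih =>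
    rw [coeffRatio_succ hw.notMem, norm_mul, norm_neg, norm_pow]
    refine mul_le_of_le_one_right (by positivity) ?_
    rw [norm_pow]
    refine pow_le_one₀ (norm_nonneg _) ?_
    rw [sub_eq_add_neg]
    refine (IsUltrametricDist.norm_add_le_max _ _).trans (max_le (by simp) ?_)
    rw [norm_neg, norm_div, norm_pow]
    exact div_le_one_of_le₀
      (ih.trans (pow_le_pow_left₀ (norm_nonneg _) (hw.norm_exp_flag_le_succ d) _)) (by positivity)

end IsMinimalFlag

end IsLattice

/-! ### The sums `∑ exp(b λ) / λ` and `∑ exp(b λ) ^ q / λ` -/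

/-- A nonarchimedean version of the dominated convergence theorem. -/
lemma CInf.tendsto_tsum {F : Type*} [Field F] [Finite F] {ι : Type*} {f : ℕ → ι → CInf F}
    {g : ι → CInf F} {a : ι → ℝ} (ha : Tendsto a cofinite (𝓝 0)) (hb : ∀ n i, ‖f n i‖ ≤ a i)
    (hg : ∀ i, Tendsto (fun n => f n i) atTop (𝓝 (g i))) :
    Tendsto (fun n => ∑' i, f n i) atTop (𝓝 (∑' i, g i)) := by
  -- The limit is treated as a value at infinity, so that convergence becomes continuity on
  -- `OnePoint ℕ` and the Weierstrass test applies.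
  let φ : ι → OnePoint ℕ → CInf F := fun i y => y.elim (g i) fun n => f n i
  have hc : Continuous fun y => ∑' i, φ i y := by
    refine CInf.continuous_tsum (a := a) (fun i => ?_) ha fun i y => ?_
    · rw [OnePoint.continuous_iff_from_nat]
      exact hg i
    · induction y using OnePoint.rec with
      | infty => exact le_of_tendsto (hg i).norm (Eventually.of_forall fun n => hb n i)
      | coe n => exact hb n i
  exact (OnePoint.continuous_iff_from_nat _).1 hc

/-- If `log V` grows by `q ^ (d + 1)` times the increment of `log ρ`, and `ρ` grows at most like
`q ^ (d / 2)`, then `V d ^ (q - 1)` is infinitely often at most `q ^ (3 / 4 * q ^ (d + 1))`. -/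
lemma exists_log_le_of_growth {q : ℕ} (hq : 1 < q) {ρ V : ℕ → ℝ} (hρ : ∀ d, 0 < ρ d)
    (hV : ∀ d, 0 < V d) (hrec : ∀ d, V (d + 1) = V d * (ρ (d + 1) / ρ d) ^ (q ^ (d + 1)))
    {C : ℝ} (hgrow : ∀ d, ρ d ≤ C * (q : ℝ) ^ (d / 2)) (N : ℕ) :
    ∃ d ≥ N, (q - 1) * Real.log (V d) ≤ 3 / 4 * Real.log q * (q : ℝ) ^ (d + 1) := by
  by_contra! hcon
  have hq1 : (1 : ℝ) < q := by exact_mod_cast hq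
  have hq0 : (0 : ℝ) < q := by linarith
  have hL : 0 < Real.log q := Real.log_pos hq1
  have hC : 0 < C := by
    have := (hρ 0).trans_le (hgrow 0)
    simpa using this
  set L := Real.log q
  let x : ℕ → ℝ := fun d => Real.log (ρ d)
  -- With this normalisation the recursion becomes a relaxation of `u` towards the increments of
  -- `log ρ`, and the claim is that `u d ≤ 3/4 * log q` infinitely often.
  let u : ℕ → ℝ := fun d => (q - 1) * Real.log (V d) / (q : ℝ) ^ (d + 1)
  have hu : ∀ d, u (d + 1) - u d = (1 - 1 / q) * (x (d + 1) - x d - u d) := by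
    intro d
    have hr : 0 < ρ (d + 1) / ρ d := div_pos (hρ _) (hρ _)
    have h1 : Real.log (V (d + 1)) = Real.log (V d) + (q : ℝ) ^ (d + 1) * (x (d + 1) - x d) := by
      rw [hrec, Real.log_mul (hV d).ne' (pow_pos hr _).ne', Real.log_pow,
        Real.log_div (hρ _).ne' (hρ _).ne']
      push_cast
      ring
    simp only [u]
    rw [h1]
    field_simp
    ring
  have hlow : ∀ d ≥ N, 3 / 4 * L < u d := fun d hd => by
    rw [lt_div_iff₀ (by positivity)]
    exact hcon d hd
  have hδ : 0 < 1 - 1 / (q : ℝ) := by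
    rw [sub_pos, div_lt_one hq0]; exact hq1
  -- If `u` stayed above `3/4 * L`, each step would lose more than that against the increment of
  -- `x`. These increments average at most `L/2`, so `u` would fall by a multiple of `L/4` per step.
  have htel : ∀ k : ℕ, u (N + k) ≤ u N + (1 - 1 / q) * (x (N + k) - x N - 3 / 4 * L * k) := by
    intro k
    induction k with
    | zero => simp
    | succ k ih =>
      have h1 := hu (N + k)
      have h2 := mul_lt_mul_of_pos_left (hlow (N + k) (by omega)) hδ
      rw [← add_assoc]
      push_cast
      nlinarith
  have hx : ∀ d : ℕ, x d ≤ Real.log C + L * (d / 2) := by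
    intro d
    refine (Real.log_le_log (hρ d) (hgrow d)).trans ?_
    rw [Real.log_mul hC.ne' (by positivity), Real.log_pow]
    have : ((d / 2 : ℕ) : ℝ) ≤ d / 2 := Nat.cast_div_le
    nlinarith
  let A : ℝ := u N + (1 - 1 / q) * (Real.log C + L * (N / 2) - x N)
  -- For such `k` the upper bound `A - (1 - 1/q) * (L/4) * k` for `u (N + k)` is negative.
  obtain ⟨k, hk⟩ := exists_nat_gt (A / ((1 - 1 / q) * (L / 4)))
  rw [div_lt_iff₀ (by positivity)] at hk
  have h1 := htel k
  have h2 := hlow (N + k) (by omega)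
  have h3 := mul_le_mul_of_nonneg_left (hx (N + k)) hδ.le
  push_cast at h3
  simp only [A] at hk
  nlinarith

/-! ### Passage to the limit along a minimal flag -/

namespace IsLattice

open FiniteSubspace

variable {F : Type*} [Field F] [Finite F] {Λ : Submodule F[X] (CInf F)} {w : ℕ → CInf F}

namespace IsMinimalFlag

/-- Dominated convergence with majorant `B ^ k * ‖l⁻¹‖`. For `l` in the `d`-th step, `‖b l‖ < ‖w
d‖`, so the finite exponential at `b l` has the norm of `exp_Λ(b l)`, which is at most `B`. -/
lemma tendsto_sum_exp_pow (hΛ : IsLattice Λ) (hw : IsMinimalFlag Λ w) {b : CInf F} (hb : ‖b‖ < 1)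
    {B : ℝ} (hB : ∀ l ∈ Λ, ‖expLattice Λ (b * l)‖ ≤ B) (k : ℕ) :
    Tendsto (fun d => ∑ l ∈ points Λ w d,
        exp (flag F w d) (b * ((l : Λ) : CInf F)) ^ k / ((l : Λ) : CInf F)) atTop
      (𝓝 (∑' l : {l : Λ // l ≠ 0}, expLattice Λ (b * ((l : Λ) : CInf F)) ^ k /
        ((l : Λ) : CInf F))) := by
  classical
  have hB0 : 0 ≤ B := (norm_nonneg _).trans (hB 0 Λ.zero_mem)
  let f : ℕ → {l : Λ // l ≠ 0} → CInf F := fun d l => if l ∈ points Λ w d then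
    exp (flag F w d) (b * ((l : Λ) : CInf F)) ^ k / ((l : Λ) : CInf F) else 0
  have hf : ∀ d, ∑' l, f d l = ∑ l ∈ points Λ w d,
      exp (flag F w d) (b * ((l : Λ) : CInf F)) ^ k / ((l : Λ) : CInf F) := by
    intro d
    rw [tsum_eq_sum (s := points Λ w d) fun l hl => if_neg hl]
    exact Finset.sum_congr rfl fun l hl => if_pos hl
  simp only [← hf]
  have ha := (hΛ.tendsto_norm_inv).const_mul (B ^ k)
  rw [mul_zero] at ha
  refine CInf.tendsto_tsum ha (fun d l => ?_) fun l => ?_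
  · by_cases hl : l ∈ points Λ w d
    · simp only [f, if_pos hl]
      rw [div_eq_mul_inv, norm_mul, norm_pow]
      refine mul_le_mul_of_nonneg_right (pow_le_pow_left₀ (norm_nonneg _) ?_ _) (norm_nonneg _)
      rw [mem_points] at hl
      rw [← hw.norm_expLattice_eq hΛ (d := d)]
      · exact hB _ l.1.2
      · cases d with
        | zero => exact absurd (Subtype.ext ((Submodule.mem_bot F).1 hl)) l.2
        | succ d =>
          rw [norm_mul]
          have hpos : 0 < ‖((l : Λ) : CInf F)‖ := norm_pos_iff.2 fun h => l.2 (Subtype.ext h)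
          calc ‖b‖ * ‖((l : Λ) : CInf F)‖ < 1 * ‖((l : Λ) : CInf F)‖ := by gcongr
            _ ≤ ‖w (d + 1)‖ := by
              rw [one_mul]
              exact (hw.norm_le_of_mem hl).trans (hw.norm_mono d.le_succ)
    · simp only [f, if_neg hl, norm_zero]
      positivity
  · refine (((hw.tendsto_exp_flag hΛ (b * ((l : Λ) : CInf F))).pow k).div_const _).congr' ?_
    filter_upwards [(hw.tendsto_points hΛ).eventually (eventually_ge_atTop {l})] with d hd
    simp only [f]
    rw [if_pos (hd (Finset.mem_singleton_self l))]

theorem tsum_exp_div (hΛ : IsLattice Λ) (hw : IsMinimalFlag Λ w) {b : CInf F} (hb : ‖b‖ < 1)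
    {B : ℝ} (hB : ∀ l ∈ Λ, ‖expLattice Λ (b * l)‖ ≤ B) :
    ∑' l : {l : Λ // l ≠ 0}, expLattice Λ (b * ((l : Λ) : CInf F)) / ((l : Λ) : CInf F) = -b := by
  classical
  have h := (hw.tendsto_sum_exp_pow hΛ hb hB 1).comp (tendsto_add_atTop_nat 1)
  simp only [pow_one] at h
  refine tendsto_nhds_unique h ?_
  have hq := Finite.one_lt_card (α := F)
  have h2 : Tendsto (fun d : ℕ => -b + b ^ (Nat.card F ^ (d + 1))) atTop (𝓝 (-b + 0)) :=
    tendsto_const_nhds.add ((tendsto_pow_atTop_nhds_zero_of_norm_lt_one hb).comp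
      ((tendsto_pow_atTop_atTop_of_one_lt hq).comp (tendsto_add_atTop_nat 1)))
  rw [add_zero] at h2
  refine h2.congr fun d => ?_
  rw [← sum_exp_div hw.notMem]
  exact (hw.sum_points (d + 1) fun l => exp (flag F w (d + 1)) (b * l) / l).symm

lemma norm_algebraMap_le (P : F[X]) {n : ℕ} (hP : P.natDegree ≤ n) :
    ‖algebraMap F[X] (CInf F) P‖ ≤ (Nat.card F : ℝ) ^ n := by
  have hq : (1 : ℝ) ≤ Nat.card F := by exact_mod_cast (Finite.one_lt_card (α := F)).le
  rw [P.as_sum_range' (n + 1) (by omega), map_sum]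
  refine IsUltrametricDist.norm_sum_le_of_forall_le_of_nonneg (by positivity) fun i hi => ?_
  have hX : ‖algebraMap F[X] (CInf F) X‖ = Nat.card F := by
    rw [IsScalarTower.algebraMap_apply F[X] (KInf F) (CInf F), norm_algebraMap', KInf.algebraMap_X,
      KInf.norm_theta]
  rw [← C_mul_X_pow_eq_monomial, ← smul_eq_C_mul, ← IsScalarTower.coe_toAlgHom' F F[X] (CInf F),
    map_smul]
  refine (CInf.norm_fsmul_le _ _).trans ?_
  rw [IsScalarTower.coe_toAlgHom', map_pow, norm_pow, hX]
  exact pow_le_pow_right₀ hq (by simpa [Nat.lt_succ_iff] using hi)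

/-- Combinations of two independent vectors with polynomial coefficients of degree at most `d / 2`
are too numerous to fit into the `d`-th step, so one of them bounds `‖w d‖`. -/
lemma norm_growth (hw : IsMinimalFlag Λ w) {p : Fin 2 → Λ} (hp : LinearIndependent F[X] p) :
    ∃ C : ℝ, ∀ d, ‖w d‖ ≤ C * (Nat.card F : ℝ) ^ (d / 2) := by
  have hq := Finite.one_lt_card (α := F)
  refine ⟨max ‖(p 0 : CInf F)‖ ‖(p 1 : CInf F)‖, fun d => ?_⟩
  set n := d / 2
  let e : (Fin 2 → Fin (n + 1) → F) → Λ := fun f =>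
    ∑ i, ((degreeLTEquiv F (n + 1)).symm (f i) : F[X]) • p i
  have he : Function.Injective e := by
    intro f g hfg
    have h1 := Fintype.linearIndependent_iff.1 hp
      (fun i => ((degreeLTEquiv F (n + 1)).symm (f i) : F[X]) -
        ((degreeLTEquiv F (n + 1)).symm (g i) : F[X])) (by
        simp only [sub_smul, Finset.sum_sub_distrib]
        exact sub_eq_zero.2 hfg)
    funext i
    exact (degreeLTEquiv F (n + 1)).symm.injective (Subtype.ext (sub_eq_zero.1 (h1 i)))
  obtain ⟨f, hf⟩ : ∃ f, ((e f : Λ) : CInf F) ∉ flag F w d := by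
    by_contra! h
    have hle := Nat.card_le_card_of_injective
      (fun f => (⟨(e f : CInf F), h f⟩ : flag F w d)) fun f g hfg => by
        have hval : (e f : CInf F) = e g :=
          congrArg (fun z : flag F w d => (z : CInf F)) hfg
        exact he (Subtype.ext hval)
    rw [card_flag hw.notMem, Nat.card_fun, Nat.card_fun, Nat.card_fin, Nat.card_fin, ← pow_mul,
      Nat.pow_le_pow_iff_right hq] at hle
    -- The count would give `2 * (d / 2 + 1) ≤ d`, which fails for both parities of `d`.
    omega
  refine (hw.norm_le d _ (e f).2 hf).trans ?_
  have hdeg : ∀ i, ‖algebraMap F[X] (CInf F) ((degreeLTEquiv F (n + 1)).symm (f i) : F[X])‖ ≤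
      (Nat.card F : ℝ) ^ n := fun i => norm_algebraMap_le _ (by
    have := mem_degreeLT.1 ((degreeLTEquiv F (n + 1)).symm (f i)).2
    exact natDegree_le_of_degree_le (Order.lt_succ_iff.1 (by exact_mod_cast this)))
  have hval : ((e f : Λ) : CInf F) =
      ∑ i, algebraMap F[X] (CInf F) ((degreeLTEquiv F (n + 1)).symm (f i) : F[X]) *
        (p i : CInf F) := by
    simp only [e, AddSubmonoidClass.coe_finsetSum, Submodule.coe_smul, Algebra.smul_def]
  rw [hval]
  refine IsUltrametricDist.norm_sum_le_of_forall_le_of_nonneg (by positivity) fun i _ => ?_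
  rw [norm_mul, mul_comm]
  refine mul_le_mul ?_ (hdeg i) (norm_nonneg _) (by positivity)
  fin_cases i
  · exact le_max_left _ _
  · exact le_max_right _ _

/-- The finite sums need only be small infinitely often, since they converge. The growth of
`coeffRatio`, at most `q ^ (3/4 * q ^ (d + 1))` for such `d`, loses against `‖b‖ ^ (q ^ (d + 1))`
and leaves `q ^ (-1/4 * q ^ (d + 1))`. -/
theorem tsum_exp_pow_div (hΛ : IsLattice Λ) (hw : IsMinimalFlag Λ w) {p : Fin 2 → Λ}
    (hp : LinearIndependent F[X] p) {b : CInf F} (hb : ‖b‖ ≤ (Nat.card F : ℝ)⁻¹)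
    {B : ℝ} (hB : ∀ l ∈ Λ, ‖expLattice Λ (b * l)‖ ≤ B) :
    ∑' l : {l : Λ // l ≠ 0},
      expLattice Λ (b * ((l : Λ) : CInf F)) ^ Nat.card F / ((l : Λ) : CInf F) = 0 := by
  classical
  have hq := Finite.one_lt_card (α := F)
  have hq1 : (1 : ℝ) < Nat.card F := by exact_mod_cast hq
  have hq0 : (0 : ℝ) < Nat.card F := by linarith
  have hL : 0 < Real.log (Nat.card F) := Real.log_pos hq1
  have hb1 : ‖b‖ < 1 := hb.trans_lt (inv_lt_one_of_one_lt₀ hq1)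
  have h := (hw.tendsto_sum_exp_pow hΛ hb1 hB (Nat.card F)).comp (tendsto_add_atTop_nat 1)
  have hval : ∀ d, ‖∑ l ∈ points Λ w (d + 1),
      exp (flag F w (d + 1)) (b * ((l : Λ) : CInf F)) ^ Nat.card F / ((l : Λ) : CInf F)‖ ≤
      ‖exp (flag F w d) (w d)‖ ^ (Nat.card F - 1) *
        ((Nat.card F : ℝ)⁻¹) ^ (Nat.card F ^ (d + 1)) := by
    intro d
    rw [hw.sum_points (d + 1) fun l => exp (flag F w (d + 1)) (b * l) ^ Nat.card F / l,
      sum_exp_pow_div hw.notMem, norm_mul]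
    refine mul_le_mul (hw.norm_coeffRatio_le d) ?_ (norm_nonneg _) (by positivity)
    have h1 : ‖b ^ (Nat.card F ^ (d + 1))‖ ≤ ((Nat.card F : ℝ)⁻¹) ^ (Nat.card F ^ (d + 1)) := by
      rw [norm_pow]; exact pow_le_pow_left₀ (norm_nonneg _) hb _
    have h2 : ‖b ^ (Nat.card F ^ (d + 2))‖ ≤ ‖b ^ (Nat.card F ^ (d + 1))‖ := by
      rw [norm_pow, norm_pow]
      exact pow_le_pow_of_le_one (norm_nonneg _) hb1.le (Nat.pow_le_pow_right hq.le (by omega))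
    rw [sub_eq_add_neg]
    refine (IsUltrametricDist.norm_add_le_max _ _).trans (max_le h1 ?_)
    rw [norm_neg]
    exact h2.trans h1
  obtain ⟨C, hC⟩ := hw.norm_growth hp
  have hVpos : ∀ d, 0 < ‖exp (flag F w d) (w d)‖ := fun d =>
    norm_pos_iff.2 (exp_ne_zero _ (hw.notMem d))
  have hsmall : Tendsto (fun d : ℕ => Real.exp (-(Real.log (Nat.card F) / 4 *
      (Nat.card F : ℝ) ^ (d + 1)))) atTop (𝓝 0) :=
    Real.tendsto_exp_neg_atTop_nhds_zero.comp (Tendsto.const_mul_atTop (by positivity)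
      ((tendsto_pow_atTop_atTop_of_one_lt hq1).comp (tendsto_add_atTop_nat 1)))
  by_contra hne
  have hev := (h.norm.eventually (lt_mem_nhds (half_lt_self (norm_pos_iff.2 hne)))).and
    (hsmall.eventually (gt_mem_nhds (half_pos (norm_pos_iff.2 hne))))
  obtain ⟨N, hN⟩ := eventually_atTop.1 hev
  obtain ⟨d, hd, hle⟩ := exists_log_le_of_growth hq (fun d => hw.norm_pos d) hVpos
    (fun d => hw.norm_exp_flag_succ d) hC N
  obtain ⟨h1, h2⟩ := hN d hd
  refine absurd (h1.trans_le ((hval d).trans ?_)) (not_lt.2 h2.le)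
  rw [← Real.exp_log (hVpos d), ← Real.exp_log (inv_pos.2 hq0), ← Real.exp_nat_mul,
    ← Real.exp_nat_mul, ← Real.exp_add, Real.exp_le_exp, Real.log_inv, Nat.cast_sub hq.le]
  push_cast
  linarith

end IsMinimalFlag

end IsLattice

/-! ### The pairing of the special functions -/

section SpecialFunctions

variable {F : Type*} [Field F] [Finite F] {Λ : Submodule F[X] (CInf F)}

/-- `ev(ζ ⊗ y) = -∑_{λ ≠ 0} λ⁻¹ y(λ)`. -/
lemma IsLattice.ev_zeta (hΛ : IsLattice Λ) (y : CompletedTensor F (Λ →ₗ[F[X]] Ω[F[X]⁄F]))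
    (h : Module.Dual F Ω[F[X]⁄F]) :
    ev hΛ.zeta y h =
      -∑' l : {l : Λ // l ≠ 0}, y (evalDual l.1 h) / ((l : Λ) : CInf F) := by
  classical
  let β := Module.Basis.ofVectorSpace F Λ
  obtain ⟨B, hB⟩ := CompletedTensor.exists_bound y
  have hB0 : 0 ≤ B := (norm_nonneg _).trans (hB 0)
  let f : Module.Basis.ofVectorSpaceIndex F Λ → {l : Λ // l ≠ 0} → CInf F := fun i l =>
    β.coord i l.1 • (y (evalDual (β i) h) / ((l : Λ) : CInf F))
  have hbound : ∀ i l, ‖f i l‖ ≤ B * ‖((l : Λ) : CInf F)⁻¹‖ := fun i l => by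
    refine (CInf.norm_fsmul_le _ _).trans ?_
    rw [div_eq_mul_inv, norm_mul]
    exact mul_le_mul_of_nonneg_right (hB _) (norm_nonneg _)
  -- Only finitely many `l` have a majorant of at least `ε`, and each of them has finitely many
  -- nonzero coordinates. This permits summing over the basis first.
  have hsum : Summable (Function.uncurry f) := by
    refine NonarchimedeanAddGroup.summable_of_tendsto_cofinite_zero ?_
    rw [Metric.tendsto_nhds]
    intro ε hε
    have ha := hΛ.tendsto_norm_inv.const_mul B
    rw [mul_zero] at ha
    have hfin : {l : {l : Λ // l ≠ 0} | ¬ B * ‖((l : Λ) : CInf F)⁻¹‖ < ε}.Finite :=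
      ha.eventually (gt_mem_nhds hε)
    refine (hfin.biUnion (t := fun l => (fun i => (i, l)) '' (β.repr l.1).support)
      fun l _ => (Finset.finite_toSet _).image _).subset ?_
    rintro ⟨i, l⟩ hil
    replace hil : ¬ dist (f i l) 0 < ε := hil
    rw [dist_zero_right] at hil
    simp only [Set.mem_iUnion]
    refine ⟨l, fun hl => hil ((hbound i l).trans_lt hl), i, ?_, rfl⟩
    rw [Finset.mem_coe, Finsupp.mem_support_iff]
    intro h0
    refine hil ?_
    have : f i l = 0 := by
      change β.repr l.1 i • _ = _
      rw [h0, zero_smul]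
    rwa [this, norm_zero]
  have hz : ∀ i, hΛ.zeta (β.coord i) * y (evalDual (β i) h) = -∑' l, f i l := by
    intro i
    change (-∑' l : {l : Λ // l ≠ 0}, β.coord i l • ((l : Λ) : CInf F)⁻¹) * _ = _
    rw [neg_mul, ← tsum_mul_right]
    refine congrArg _ (tsum_congr fun l => ?_)
    rw [smul_mul_assoc, mul_comm, ← div_eq_mul_inv]
  change ∑' i, hΛ.zeta (β.coord i) * y (evalDual (β i) h) = _
  simp only [hz]
  rw [tsum_neg, ← hsum.tsum_comm]
  refine congrArg _ (tsum_congr fun l => ?_)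
  rw [tsum_eq_sum (s := (β.repr l.1).support)]
  · have hl := β.linearCombination_repr l.1
    rw [Finsupp.linearCombination_apply, Finsupp.sum] at hl
    have h1 : evalDual l.1 h = ∑ i ∈ (β.repr l.1).support, β.repr l.1 i • evalDual (β i) h := by
      refine LinearMap.ext fun μ => ?_
      rw [LinearMap.sum_apply]
      change h (μ _) = _
      nth_rewrite 1 [← hl]
      rw [map_sum, map_sum]
      refine Finset.sum_congr rfl fun i _ => ?_
      rw [← algebraMap_smul F[X] (β.repr l.1 i) (β i), map_smul, algebraMap_smul, map_smul]
      rfl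
    rw [h1, map_sum, Finset.sum_div]
    refine Finset.sum_congr rfl fun i _ => ?_
    rw [map_smul, smul_div_assoc]
    rfl
  · intro i hi
    change β.repr l.1 i • _ = _
    rw [Finsupp.notMem_support_iff.1 hi, zero_smul]

/-! ### Residues and the values of the pairings -/

/-- Functionals on `Ω` are residues against elements of `K∞` without polynomial part. -/
lemma KInf.exists_residue (h : Module.Dual F Ω[F[X]⁄F]) :
    ∃ b : KInf F, (∀ n : ℤ, n < 1 → KInf.coeff n b = 0) ∧
      ∀ j : ℕ, KInf.coeff (j + 1) b = h ((X ^ j : F[X]) • KaehlerDifferential.D F F[X] X) := by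
  -- The residue of `b θ^j dθ` is the coefficient of `θ^(-j-1)` in `b`, whence the shift `n - 1`;
  -- the constant coefficient is set to `0`.
  let b : KInf F := (HahnSeries.ofPowerSeries ℤ F (PowerSeries.mk fun n =>
    if n = 0 then 0 else h ((X ^ (n - 1) : F[X]) • KaehlerDifferential.D F F[X] X)) :
      LaurentSeries F)
  have hb : ∀ n : ℕ, KInf.coeff (n : ℤ) b =
      if n = 0 then 0 else h ((X ^ (n - 1) : F[X]) • KaehlerDifferential.D F F[X] X) := fun n =>
    (HahnSeries.ofPowerSeries_apply_coeff (Γ := ℤ) _ n).trans (PowerSeries.coeff_mk _ _)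
  refine ⟨b, fun n hn => ?_, fun j => ?_⟩
  · rcases lt_or_eq_of_le (Int.le_of_lt_add_one hn : n ≤ 0) with hn | rfl
    · exact (PowerSeries.coeff_coe (PowerSeries.mk _) n).trans (if_pos hn)
    · exact (hb 0).trans (if_pos rfl)
  · have := hb (j + 1)
    push_cast at this
    simpa using this

lemma KInf.norm_le_of_coeff {b : KInf F} (hb : ∀ n : ℤ, n < 1 → KInf.coeff n b = 0) :
    ‖algebraMap (KInf F) (CInf F) b‖ ≤ (Nat.card F : ℝ)⁻¹ := by
  rw [norm_algebraMap', ← KInf.norm_theta, ← norm_inv]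
  have := KInf.norm_le_theta_inv_pow (k := 1) (by simpa using hb)
  rwa [pow_one] at this

lemma KInf.dual_eq_residue {h : Module.Dual F Ω[F[X]⁄F]} {b : KInf F}
    (hb : ∀ j : ℕ, KInf.coeff (j + 1) b = h ((X ^ j : F[X]) • KaehlerDifferential.D F F[X] X))
    (m : Ω[F[X]⁄F]) : h m = KInf.coeff 1
      (b * algebraMap F[X] (KInf F) (KaehlerDifferential.polynomialEquiv F m)) := by
  have key : ∀ p : F[X], h (p • KaehlerDifferential.D F F[X] X) =
      KInf.coeff 1 (b * algebraMap F[X] (KInf F) p) := by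
    intro p
    induction p using Polynomial.induction_on' with
    | add p q hp hq =>
      rw [add_smul, map_add, hp, hq, map_add (algebraMap F[X] (KInf F)), mul_add, map_add]
    | monomial n a =>
      rw [← C_mul_X_pow_eq_monomial, mul_smul, map_mul (algebraMap F[X] (KInf F)),
        map_pow (algebraMap F[X] (KInf F)), KInf.algebraMap_X, mul_left_comm,
        show algebraMap F[X] (KInf F) (C a) = algebraMap F (KInf F) a from
          (IsScalarTower.algebraMap_apply F F[X] (KInf F) a).symm,
        ← Algebra.smul_def, map_smul (KInf.coeff 1), KInf.coeff_mul_theta_pow, add_comm, hb,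
        ← map_smul h]
      exact congrArg h (algebraMap_smul F[X] a _)
  rw [← key]
  congr 1
  apply (KaehlerDifferential.polynomialEquiv F).injective
  simp

namespace IsLattice

lemma omega_evalDual (hΛ : IsLattice Λ) {h : Module.Dual F Ω[F[X]⁄F]} {b : KInf F}
    (hb : ∀ j : ℕ, KInf.coeff (j + 1) b = h ((X ^ j : F[X]) • KaehlerDifferential.D F F[X] X))
    (l : Λ) : hΛ.omega (evalDual l h) =
      expLattice Λ (algebraMap (KInf F) (CInf F) b * (l : CInf F)) := by
  rw [show evalDual l h = resDual b l from LinearMap.ext fun μ => KInf.dual_eq_residue hb (μ l),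
    ← Algebra.smul_def]
  exact hΛ.existsUnique_universal.choose_spec.1 b l

/-- The values `exp_Λ(b l)` are values of `ω`, hence bounded uniformly in `l`; this is the bound
required by `tsum_exp_div`. -/
theorem ev_zeta_omega (hΛ : IsLattice Λ) (hinf : (Λ : Set (CInf F)).Infinite)
    {h : Module.Dual F Ω[F[X]⁄F]} {b : KInf F} (hb₀ : ∀ n : ℤ, n < 1 → KInf.coeff n b = 0)
    (hb : ∀ j : ℕ, KInf.coeff (j + 1) b = h ((X ^ j : F[X]) • KaehlerDifferential.D F F[X] X)) :
    ev hΛ.zeta hΛ.omega h = algebraMap (KInf F) (CInf F) b := by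
  obtain ⟨w, hw⟩ := hΛ.exists_isMinimalFlag hinf
  obtain ⟨B, hB⟩ := CompletedTensor.exists_bound hΛ.omega
  have hq1 : (1 : ℝ) < Nat.card F := by exact_mod_cast Finite.one_lt_card (α := F)
  rw [hΛ.ev_zeta]
  simp only [hΛ.omega_evalDual hb]
  rw [hw.tsum_exp_div hΛ (B := B)
    ((KInf.norm_le_of_coeff hb₀).trans_lt (inv_lt_one_of_one_lt₀ hq1)), neg_neg]
  intro l hl
  rw [← hΛ.omega_evalDual hb ⟨l, hl⟩]
  exact hB _

theorem ev_zeta_twist_omega (hΛ : IsLattice Λ) {p : Fin 2 → Λ}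
    (hinf : (Λ : Set (CInf F)).Infinite) (hp : LinearIndependent F[X] p) :
    ev hΛ.zeta (CompletedTensor.twist hΛ.omega) = 0 := by
  refine Subtype.ext (LinearMap.ext fun h => ?_)
  obtain ⟨w, hw⟩ := hΛ.exists_isMinimalFlag hinf
  obtain ⟨B, hB⟩ := CompletedTensor.exists_bound hΛ.omega
  obtain ⟨b, hb₀, hb⟩ := KInf.exists_residue h
  change ev hΛ.zeta (CompletedTensor.twist hΛ.omega) h = 0
  rw [hΛ.ev_zeta]
  have htw : ∀ u, CompletedTensor.twist hΛ.omega u = hΛ.omega u ^ Nat.card F := fun _ => rfl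
  simp only [htw, hΛ.omega_evalDual hb]
  rw [hw.tsum_exp_pow_div hΛ hp (B := B) (KInf.norm_le_of_coeff hb₀), neg_zero]
  intro l hl
  rw [← hΛ.omega_evalDual hb ⟨l, hl⟩]
  exact hB _

end IsLattice

/-- Multiplication by `θ ⊗ 1 - 1 ⊗ θ` is injective. -/
lemma CompletedTensor.eq_zero_of_leftMul_eq_rightMul {M : Type*} [AddCommGroup M] [Module F M]
    [Module F[X] M] [IsScalarTower F F[X] M] (g : CompletedTensor F M)
    (hg : ∀ h : Module.Dual F M, algebraMap F[X] (CInf F) X * g h =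
      g (LinearMap.lcomp F F (Algebra.lsmul F F M (X : F[X])) h)) : g = 0 := by
  refine Subtype.ext (LinearMap.ext fun h => ?_)
  change g h = 0
  obtain ⟨B, hB⟩ := CompletedTensor.exists_bound g
  have hX : ‖algebraMap F[X] (CInf F) X‖ = Nat.card F := by
    rw [IsScalarTower.algebraMap_apply F[X] (KInf F) (CInf F), norm_algebraMap', KInf.algebraMap_X,
      KInf.norm_theta]
  have hq1 : (1 : ℝ) < Nat.card F := by exact_mod_cast Finite.one_lt_card (α := F)
  -- All multiples `θ^n g(h)` are values of `g`, which is bounded, whereas `‖θ‖ = q > 1`.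
  have hpow : ∀ n : ℕ, ∃ u, algebraMap F[X] (CInf F) X ^ n * g h = g u := by
    intro n
    induction n with
    | zero => exact ⟨h, by simp⟩
    | succ n ih =>
      obtain ⟨u, hu⟩ := ih
      exact ⟨_, by rw [pow_succ', mul_assoc, hu, hg u]⟩
  by_contra hne
  have hpos : 0 < ‖g h‖ := norm_pos_iff.2 hne
  obtain ⟨n, hn⟩ := pow_unbounded_of_one_lt (B / ‖g h‖) hq1
  obtain ⟨u, hu⟩ := hpow n
  rw [div_lt_iff₀ hpos] at hn
  have := hB u
  rw [← hu, norm_mul, norm_pow, hX] at this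
  exact absurd this (not_le.2 hn)

/-- If `h` corresponds to `b`, then `h ∘ θ` corresponds to `θ b` with its constant term removed, and
that constant term is `h(dθ)`. -/
theorem IsLattice.ev_zeta_omega_functional_equation (hΛ : IsLattice Λ)
    (hinf : (Λ : Set (CInf F)).Infinite) :
    CompletedTensor.leftMul (algebraMap F[X] (CInf F) X) (ev hΛ.zeta hΛ.omega) -
        CompletedTensor.rightMul X (ev hΛ.zeta hΛ.omega) =
      CompletedTensor.tmul 1 (KaehlerDifferential.D F F[X] X) := by
  refine Subtype.ext (LinearMap.ext fun h => ?_)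
  let h' := LinearMap.lcomp F F (Algebra.lsmul F F Ω[F[X]⁄F] (X : F[X])) h
  obtain ⟨b, hb₀, hb⟩ := KInf.exists_residue h
  obtain ⟨b', hb₀', hb'⟩ := KInf.exists_residue h'
  change algebraMap F[X] (CInf F) X * ev hΛ.zeta hΛ.omega h - ev hΛ.zeta hΛ.omega h' =
    h (KaehlerDifferential.D F F[X] X) • (1 : CInf F)
  rw [hΛ.ev_zeta_omega hinf hb₀ hb, hΛ.ev_zeta_omega hinf hb₀' hb',
    IsScalarTower.algebraMap_apply F[X] (KInf F) (CInf F), KInf.algebraMap_X, ← map_mul, ← map_sub,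
    Algebra.smul_def, mul_one, IsScalarTower.algebraMap_apply F (KInf F) (CInf F)]
  congr 1
  refine KInf.ext_coeff fun n => ?_
  rw [map_sub, mul_comm, ← pow_one (KInf.theta F), KInf.coeff_mul_theta_pow,
    Algebra.algebraMap_eq_smul_one, map_smul, ← KInf.mono_zero, KInf.coeff_mono]
  rcases lt_trichotomy n 0 with hn | rfl | hn
  · rw [hb₀ _ (by push_cast; omega), hb₀' _ (by omega), if_neg hn.ne]; simp
  · have := hb 0
    rw [hb₀' _ (by omega)]
    simpa using this
  · obtain ⟨j, rfl⟩ : ∃ j : ℕ, n = j + 1 := ⟨(n - 1).toNat, by omega⟩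
    rw [hb', if_neg hn.ne', smul_zero]
    have := hb (j + 1)
    push_cast at this ⊢
    rw [this, pow_succ', mul_smul]
    exact sub_self _

end SpecialFunctions

/-- The first identity says that `ev(ζ ⊗ ω)` is the quotient of `dθ` by `θ ⊗ 1 - 1 ⊗ θ`, i.e. the
unique solution `g ∈ ℂ∞ ⊗̂ Ω` of `(θ ⊗ 1 - 1 ⊗ θ) g = 1 ⊗ dθ`. -/
theorem mainTheorem4 {F : Type*} [Field F] [Finite F] {r : ℕ} (hr : 1 ≤ r)
    (φ : DrinfeldModule F r) (Λ : Submodule F[X] (CInf F)) (hΛ : φ.IsPeriodLattice Λ) :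
    (∀ g : CompletedTensor F Ω[F[X]⁄F],
      CompletedTensor.leftMul (algebraMap F[X] (CInf F) X) g - CompletedTensor.rightMul X g =
          CompletedTensor.tmul 1 (KaehlerDifferential.D F F[X] X) ↔
        g = ev hΛ.toIsLattice.zeta hΛ.toIsLattice.omega) ∧
    (2 ≤ r → ev hΛ.toIsLattice.zeta (CompletedTensor.twist hΛ.toIsLattice.omega) = 0) := by
  obtain ⟨_, _⟩ := hΛ.toIsLattice.free
  let β := Module.finBasisOfFinrankEq F[X] Λ hΛ.finrank_eq
  -- As `r ≥ 1`, the multiples of a basis vector by polynomials are infinitely many lattice points.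
  have hinf : (Λ : Set (CInf F)).Infinite := by
    refine Set.infinite_of_injective_forall_mem
      (f := fun a : F[X] => ((a • β ⟨0, hr⟩ : Λ) : CInf F)) (fun a a' h => ?_) fun a =>
        (a • β ⟨0, hr⟩ : Λ).2
    have h1 := congrArg (fun l => β.repr l ⟨0, hr⟩) (Subtype.ext h)
    simpa using h1
  refine ⟨fun g => ⟨fun hg => ?_, ?_⟩, fun hr2 => ?_⟩
  · have h0 := hΛ.toIsLattice.ev_zeta_omega_functional_equation hinf
    rw [← sub_eq_zero]
    refine CompletedTensor.eq_zero_of_leftMul_eq_rightMul _ fun h => ?_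
    have h1 := congrArg (fun t : CompletedTensor F Ω[F[X]⁄F] => t h) (hg.trans h0.symm)
    set G := ev hΛ.toIsLattice.zeta hΛ.toIsLattice.omega
    change algebraMap F[X] (CInf F) X * g h - g (LinearMap.lcomp F F (Algebra.lsmul F F _ (X : F[X])) h) =
      algebraMap F[X] (CInf F) X * G h - G (LinearMap.lcomp F F (Algebra.lsmul F F _ (X : F[X])) h) at h1
    change algebraMap F[X] (CInf F) X * (g h - G h) =
      g (LinearMap.lcomp F F (Algebra.lsmul F F _ (X : F[X])) h) -
        G (LinearMap.lcomp F F (Algebra.lsmul F F _ (X : F[X])) h)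
    linear_combination h1
  · rintro rfl
    exact hΛ.toIsLattice.ev_zeta_omega_functional_equation hinf
  · exact hΛ.toIsLattice.ev_zeta_twist_omega hinf
      (β.linearIndependent.comp (Fin.castLE hr2) (Fin.castLE_injective hr2))
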